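/- Let $\pi\colon E\to M$ be a smooth fibre bundle with $\dim M=m$ and fibre dimension $n$, let $\eta$ be a volume form on $M$, let $\pi^1\colon J^1\pi\to E$ be the first-order jet bundle, $\bar\pi^1=\pi\circ\pi^1\colon J^1\pi\to M$ and $\omega=\bar\pi^{1*}\eta$. Let $L\in C^\infty(J^1\pi)$, let $\mathcal L=L\,\omega$ be the associated Lagrangian density, let $\mathcal V$ be the vertical endomorphism of $J^1\pi$, a section of $T^*J^1\pi\otimes V(\pi^1)\otimes \bar\pi^{1*}TM$, given in natural coordinates $(x^\alpha,y^A,v^A_\alpha)$ by $\mathcal V=(dy^A-v^A_\alpha dx^\alpha)\otimes\partial/\partial v^A_\nu\otimes\partial/\partial x^\nu$, and let $$\Theta_{\mathcal L}=i(\mathcal V)\mathcal L+\mathcal L,\qquad \Omega_{\mathcal L}=-d\Theta_{\mathcal L}$$ be the Poincaré–Cartan forms; in natural coordinates with $\omega=d^mx=dx^1\wedge\dots\wedge dx^m$, $$\Theta_{\mathcal L}=\frac{\partial L}{\partial v^A_\alpha}\,(dy^A-v^A_\nu dx^\nu)\wedge i\Big(\frac{\partial}{\partial x^\alpha}\Big)d^mx+L\,d^mx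 .$$ Suppose that the Lagrangian system $(J^1\pi,\Omega_{\mathcal L})$ is regular: $\Omega_{\mathcal L}$ is $1$-nondegenerate (at every point, $i(Z)\Omega_{\mathcal L}=0$ implies $Z=0$), or the matrix $\big(\partial^2L/\partial v^A_\alpha\partial v^B_\nu\big)$ is nonsingular at every point of $J^1\pi$ in natural coordinates. (The first condition implies the second, and they are equivalent if $m\ge 2$ and $n\ge 1$.) Let $\mathcal X_{\mathcal L}$ be an $m$-vector field on $J^1\pi$ which is locally decomposable, that is, every point of $J^1\pi$ has an open neighbourhood on which $\mathcal X_{\mathcal L}=Y_1\wedge\dots\wedge Y_m$ for some smooth vector fields $Y_1,\dots,Y_m$, and suppose that $$i(\mathcal X_{\mathcal L})\omega=1,\qquad i(\mathcal X_{\mathcal L})\Omega_{\mathcal L}=0 .$$ Then $\mathcal X_{\mathcal L}$ is semi-holonomic, that is, $i(\mathcal X_{\mathcal L})\mathcal V=0$, where $\mathcal X_{\mathcal L}$ is contracted with the $T^*J^1\pi$ factor of $\mathcal V$. Consequently $\mathcal X_{\mathcal L}$ is an Euler–Lagrange $m$-vector field for $\mathcal L$, that is, a semi-holonomic locally decomposable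 $m$-vector field with $i(\mathcal X_{\mathcal L})\Omega_{\mathcal L}=0$. -/

import Mathlib

open Set Topology Manifold
open scoped ContDiff

noncomputable section


/-- The Euclidean space `ℝⁿ`, model space of `n`-dimensional manifolds. -/
abbrev Eu (n : ℕ) : Type := EuclideanSpace ℝ (Fin n)

/-- A smooth fibre bundle `π : E → M` with typical fibre `F`, where `dim M = m`, `dim F = n`. -/
structure SmoothFibreBundle (m n : ℕ) (M F E : Type*)
    [TopologicalSpace M] [ChartedSpace (Eu m) M]
    [TopologicalSpace F] [ChartedSpace (Eu n) F]
    [TopologicalSpace E] [ChartedSpace (Eu (m + n)) E] where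
  /-- the projection `π` -/
  proj : E → M
  /-- `π` is locally trivial: the trivialisations are diffeomorphisms `π⁻¹(U) ≅ U × F` over `U` -/
  exists_trivialization : ∀ x : M, ∃ e : Bundle.Trivialization F proj, x ∈ e.baseSet ∧
    ContMDiffOn (𝓡 (m + n)) ((𝓡 m).prod (𝓡 n)) ∞ e e.source ∧
    ContMDiffOn ((𝓡 m).prod (𝓡 n)) (𝓡 (m + n)) ∞ e.toOpenPartialHomeomorph.symm e.target

section Forms

variable {V : Type*} [NormedAddCommGroup V] [NormedSpace ℝ V]
  {N : Type*} [TopologicalSpace N] [ChartedSpace V N]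

/-- The coordinate expression of a `k`-form `α` on `N` in the preferred chart `φ` at `p`, that is,
the pullback `(φ⁻¹)^* α`. -/
def chartForm {k : ℕ} (α : (q : N) → TangentSpace 𝓘(ℝ, V) q [⋀^Fin k]→L[ℝ] ℝ) (p : N) (z : V) :
    V [⋀^Fin k]→L[ℝ] ℝ :=
  (α ((chartAt V p).symm z)).compContinuousLinearMap
    (mfderiv 𝓘(ℝ, V) 𝓘(ℝ, V) (chartAt V p).symm z)

/-- Smoothness of a differential form. -/
def IsSmoothForm {k : ℕ} (α : (q : N) → TangentSpace 𝓘(ℝ, V) q [⋀^Fin k]→L[ℝ] ℝ) : Prop :=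
  ∀ p : N, ContDiffOn ℝ ∞ (chartForm α p) (chartAt V p).target

/-- The exterior derivative of a differential form, computed at `p` in the chart at `p`. -/
def manifoldExtDeriv {k : ℕ} (α : (q : N) → TangentSpace 𝓘(ℝ, V) q [⋀^Fin k]→L[ℝ] ℝ) (p : N) :
    TangentSpace 𝓘(ℝ, V) p [⋀^Fin (k + 1)]→L[ℝ] ℝ :=
  (extDeriv (chartForm α p) (chartAt V p p)).compContinuousLinearMap
    (mfderiv 𝓘(ℝ, V) 𝓘(ℝ, V) (chartAt V p) p)

/-- An `m`-vector field is locally decomposable if it is locally `Y₁ ∧ … ∧ Y_m` for smooth local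
vector fields `Y₁, …, Y_m`. -/
def IsLocallyDecomposable [IsManifold 𝓘(ℝ, V) ∞ N] {m : ℕ}
    (X : (q : N) → ⋀[ℝ]^m (TangentSpace 𝓘(ℝ, V) q)) : Prop :=
  ∀ p : N, ∃ U : Set N, IsOpen U ∧ p ∈ U ∧
    ∃ Y : Fin m → (q : N) → TangentSpace 𝓘(ℝ, V) q,
      (∀ i, ContMDiffOn 𝓘(ℝ, V) 𝓘(ℝ, V).tangent ∞
        (fun q => (⟨q, Y i q⟩ : TangentBundle 𝓘(ℝ, V) N)) U) ∧
      ∀ q ∈ U, X q = exteriorPower.ιMulti ℝ m (fun i => Y i q)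

end Forms

section LinearAlgebra

variable {V : Type*} [AddCommGroup V] [Module ℝ V] [TopologicalSpace V]

/-- `i(X)α` for an `m`-vector `X` and an `m`-form `α`;
`i(Y₁ ∧ … ∧ Y_m)α = α(Y₁, …, Y_m)`. -/
def mvPair {m : ℕ} (X : ⋀[ℝ]^m V) (α : V [⋀^Fin m]→L[ℝ] ℝ) : ℝ :=
  exteriorPower.alternatingMapLinearEquiv α.toAlternatingMap X

/-- `i(X)Ω` for an `m`-vector `X` and an `(m+1)`-form `Ω`; it is the `1`-form with
`[i(Y₁ ∧ … ∧ Y_m)Ω](w) = Ω(Y₁, …, Y_m, w) = (-1)^m Ω(w, Y₁, …, Y_m)`. -/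
def mvContract {m : ℕ} (X : ⋀[ℝ]^m V) (Ω : V [⋀^Fin (m + 1)]→L[ℝ] ℝ) : V →ₗ[ℝ] ℝ :=
  (-1 : ℝ) ^ m • (LinearMap.applyₗ X ∘ₗ
    (exteriorPower.alternatingMapLinearEquiv (R := ℝ) (M := V) (N := ℝ) (n := m)).toLinearMap ∘ₗ
      Ω.toAlternatingMap.curryLeft)

/-- A form `Ω` of positive degree is `1`-nondegenerate if `i(Z)Ω = 0` only for `Z = 0`. -/
def IsOneNondegenerate {m : ℕ} (Ω : V [⋀^Fin (m + 1)]→L[ℝ] ℝ) : Prop :=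
  ∀ Z : V, (∀ w : Fin m → V, Ω (Fin.cons Z w) = 0) → Z = 0

variable {W : Type*} [AddCommGroup W] [Module ℝ W] [TopologicalSpace W]

theorem tensorContract_aux {m : ℕ} (P T : V →L[ℝ] W) (Z : Fin m → V) (i k : Fin m) (x : V) :
    Function.update (fun j => T (Function.update Z i x j)) k (P (Function.update Z i x k)) =
      Function.update (Function.update (fun j => T (Z j)) i (T x)) k
        (P (Function.update Z i x k)) := by
  congr 1
  funext j
  rcases eq_or_ne j i with rfl | h
  · simp
  · simp [h]

/-- The contraction `i(P)η` of a tensor `P = ∑ a ⊗ w ∈ V^* ⊗ W`, seen as a linear map `P : V → W`,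
with the pullback by `T : V → W` of an `m`-form `η` on `W`: it is `∑ a ∧ T^* i(w)η`, that is,
`(Z₁, …, Z_m) ↦ ∑ᵢ η(T Z₁, …, P Zᵢ, …, T Z_m)` (with `P Zᵢ` in the `i`-th position). -/
def tensorContract {m : ℕ} (P T : V →L[ℝ] W) (η : W [⋀^Fin m]→L[ℝ] ℝ) :
    V [⋀^Fin m]→L[ℝ] ℝ where
  toFun Z := ∑ i, η (Function.update (fun j => T (Z j)) i (P (Z i)))
  map_update_add' {inst} Z i x y := by
    obtain rfl : inst = instDecidableEqFin m := Subsingleton.elim _ _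
    rw [← Finset.sum_add_distrib]
    refine Finset.sum_congr rfl fun k _ => ?_
    rw [tensorContract_aux, tensorContract_aux, tensorContract_aux]
    rcases eq_or_ne k i with rfl | h
    · simp
    · simp only [Function.update_comm h.symm, Function.update_of_ne h]
      rw [map_add, η.map_update_add]
  map_update_smul' {inst} Z i c x := by
    obtain rfl : inst = instDecidableEqFin m := Subsingleton.elim _ _
    rw [Finset.smul_sum]
    refine Finset.sum_congr rfl fun k _ => ?_
    rw [tensorContract_aux, tensorContract_aux]
    rcases eq_or_ne k i with rfl | h
    · simp
    · simp only [Function.update_comm h.symm, Function.update_of_ne h]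
      rw [map_smul, η.map_update_smul]
  map_eq_zero_of_eq' Z i k hik hne := by
    rw [Fintype.sum_eq_add i k hne]
    · rw [← hik]
      have h : Function.update (fun j => T (Z j)) k (P (Z i)) =
          Function.update (fun j => T (Z j)) i (P (Z i)) ∘ Equiv.swap i k := by
        funext l
        rcases eq_or_ne l i with rfl | hli
        · simp [hne, hne.symm, hik]
        · rcases eq_or_ne l k with rfl | hlk
          · simp
          · simp [hli, hlk, Equiv.swap_apply_of_ne_of_ne]
      rw [h]
      have h2 := η.toAlternatingMap.map_swap (Function.update (fun j => T (Z j)) i (P (Z i))) hne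
      have h3 : η (Function.update (fun j => T (Z j)) i (P (Z i)) ∘ Equiv.swap i k) =
        - η (Function.update (fun j => T (Z j)) i (P (Z i))) := h2
      rw [h3, add_neg_cancel]
    · rintro l ⟨hli, hlk⟩
      refine η.map_eq_zero_of_eq _ (i := i) (j := k) ?_ hne
      simp [Function.update_of_ne hli.symm, Function.update_of_ne hlk.symm, hik]
  cont := by
    refine continuous_finsetSum _ fun i _ => η.cont.comp ?_
    exact Continuous.update (by fun_prop) i (by fun_prop)

end LinearAlgebra

namespace SmoothFibreBundle

variable {m n : ℕ} {M F E : Type*}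
  [TopologicalSpace M] [ChartedSpace (Eu m) M] [IsManifold (𝓡 m) ∞ M]
  [TopologicalSpace F] [ChartedSpace (Eu n) F] [IsManifold (𝓡 n) ∞ F]
  [TopologicalSpace E] [ChartedSpace (Eu (m + n)) E] [IsManifold (𝓡 (m + n)) ∞ E]
  (B : SmoothFibreBundle m n M F E)

/-- The tangent map `T_y π : T_y E → T_{π(y)} M`. -/
def dproj (y : E) : Eu (m + n) →L[ℝ] Eu m := mfderiv (𝓡 (m + n)) (𝓡 m) B.proj y

/-- Fibred coordinates `(x^α, y^A)` on an open subset of `E`, over coordinates `(x^α)` on an open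
subset of `M`. -/
structure FibredChart where
  base : OpenPartialHomeomorph M (Eu m)
  total : OpenPartialHomeomorph E (Eu m × Eu n)
  base_smooth : ContMDiffOn (𝓡 m) (𝓡 m) ∞ base base.source
  base_symm_smooth : ContMDiffOn (𝓡 m) (𝓡 m) ∞ base.symm base.target
  total_smooth : ContMDiffOn (𝓡 (m + n)) 𝓘(ℝ, Eu m × Eu n) ∞ total total.source
  total_symm_smooth : ContMDiffOn 𝓘(ℝ, Eu m × Eu n) (𝓡 (m + n)) ∞ total.symm total.target
  proj_mem : ∀ y ∈ total.source, B.proj y ∈ base.source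
  base_proj : ∀ y ∈ total.source, base (B.proj y) = (total y).1

theorem exists_fibredChart (y : E) : ∃ c : B.FibredChart, y ∈ c.total.source := by
  obtain ⟨e, he, hs, hs'⟩ := B.exists_trivialization (B.proj y)
  have hye : y ∈ e.source := by rw [e.source_eq]; exact he
  set φ := chartAt (Eu m) (B.proj y) with hφ
  set ψ := chartAt (Eu n) (e y).2 with hψ
  have hφs : ContMDiffOn (𝓡 m) (𝓡 m) ∞ φ φ.source := contMDiffOn_chart
  have hφs' : ContMDiffOn (𝓡 m) (𝓡 m) ∞ φ.symm φ.target := contMDiffOn_chart_symm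
  have hψs : ContMDiffOn (𝓡 n) (𝓡 n) ∞ ψ ψ.source := contMDiffOn_chart
  have hψs' : ContMDiffOn (𝓡 n) (𝓡 n) ∞ ψ.symm ψ.target := contMDiffOn_chart_symm
  let T : OpenPartialHomeomorph E (Eu m × Eu n) := e.toOpenPartialHomeomorph.trans (φ.prod ψ)
  have hT : ∀ z ∈ T.source, z ∈ e.source ∧ (e z).1 ∈ φ.source ∧ (e z).2 ∈ ψ.source := by
    intro z hz
    rw [OpenPartialHomeomorph.trans_source] at hz
    exact ⟨hz.1, hz.2.1, hz.2.2⟩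
  have hT' : ∀ z ∈ T.target, z.1 ∈ φ.target ∧ z.2 ∈ ψ.target ∧
      (φ.symm z.1, ψ.symm z.2) ∈ e.target := by
    intro z hz
    rw [OpenPartialHomeomorph.trans_target] at hz
    exact ⟨hz.1.1, hz.1.2, hz.2⟩
  refine ⟨⟨φ, T, hφs, hφs', ?_, ?_, ?_, ?_⟩, ?_⟩
  · have h := hs.mono (fun z hz => (hT z hz).1)
    exact (hφs.comp (contMDiff_fst.comp_contMDiffOn h) fun z hz => (hT z hz).2.1).prodMk_space
      (hψs.comp (contMDiff_snd.comp_contMDiffOn h) fun z hz => (hT z hz).2.2)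
  · refine hs'.comp (t := e.target) (f := fun z : Eu m × Eu n => (φ.symm z.1, ψ.symm z.2)) ?_ ?_
    · have h1 : ContMDiffOn 𝓘(ℝ, Eu m × Eu n) (𝓡 m) ∞ (fun z : Eu m × Eu n => z.1) T.target :=
        contDiff_fst.contMDiff.contMDiffOn
      have h2 : ContMDiffOn 𝓘(ℝ, Eu m × Eu n) (𝓡 n) ∞ (fun z : Eu m × Eu n => z.2) T.target :=
        contDiff_snd.contMDiff.contMDiffOn
      exact (hφs'.comp h1 fun z hz => (hT' z hz).1).prodMk
        (hψs'.comp h2 fun z hz => (hT' z hz).2.1)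
    · exact fun z hz => (hT' z hz).2.2
  · intro z hz
    rw [← e.coe_fst (hT z hz).1]
    exact (hT z hz).2.1
  · intro z hz
    rw [← e.coe_fst (hT z hz).1]
    rfl
  · change y ∈ (e.toOpenPartialHomeomorph.trans (φ.prod ψ)).source
    rw [OpenPartialHomeomorph.trans_source]
    refine ⟨hye, ?_, ?_⟩
    · change (e y).1 ∈ φ.source
      rw [e.coe_fst hye]
      exact mem_chart_source _ _
    · exact mem_chart_source _ _

/-- The first-order jet bundle `J¹π`: a point over `y ∈ E` is the tangent map
`T_{π(y)} M → T_y E` at `π(y)` of a local section of `π` through `y`, that is,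
a linear right inverse of `T_y π`. -/
structure J1 where
  /-- the target `y = π¹(j)` -/
  pt : E
  /-- the linear map `T_{π(y)} M → T_y E` -/
  lin : Eu m →L[ℝ] Eu (m + n)
  right_inv : (B.dproj pt).comp lin = ContinuousLinearMap.id ℝ (Eu m)


namespace FibredChart

variable {B} (c c' : B.FibredChart)

/-- Tangent map of the fibred chart of `E`. -/
def dtotal (y : E) : Eu (m + n) →L[ℝ] Eu m × Eu n :=
  mfderiv (𝓡 (m + n)) 𝓘(ℝ, Eu m × Eu n) c.total y

/-- Tangent map of the inverse of the fibred chart of `E`. -/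
def dtotalSymm (z : Eu m × Eu n) : Eu m × Eu n →L[ℝ] Eu (m + n) :=
  mfderiv 𝓘(ℝ, Eu m × Eu n) (𝓡 (m + n)) c.total.symm z

/-- Tangent map of the chart of `M`. -/
def dbase (x : M) : Eu m →L[ℝ] Eu m := mfderiv (𝓡 m) (𝓡 m) c.base x

/-- Tangent map of the inverse of the chart of `M`. -/
def dbaseSymm (u : Eu m) : Eu m →L[ℝ] Eu m := mfderiv (𝓡 m) (𝓡 m) c.base.symm u

theorem total_mdiff : c.total.MDifferentiable (𝓡 (m + n)) 𝓘(ℝ, Eu m × Eu n) :=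
  ⟨c.total_smooth.mdifferentiableOn (by simp), c.total_symm_smooth.mdifferentiableOn (by simp)⟩

theorem base_mdiff : c.base.MDifferentiable (𝓡 m) (𝓡 m) :=
  ⟨c.base_smooth.mdifferentiableOn (by simp), c.base_symm_smooth.mdifferentiableOn (by simp)⟩

theorem dtotalSymm_dtotal {y : E} (hy : y ∈ c.total.source) :
    (c.dtotalSymm (c.total y)).comp (c.dtotal y) = ContinuousLinearMap.id ℝ _ :=
  c.total_mdiff.symm_comp_deriv hy

theorem dtotal_dtotalSymm {z : Eu m × Eu n} (hz : z ∈ c.total.target) :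
    (c.dtotal (c.total.symm z)).comp (c.dtotalSymm z) = ContinuousLinearMap.id ℝ _ :=
  c.total_mdiff.comp_symm_deriv hz

theorem dbaseSymm_dbase {x : M} (hx : x ∈ c.base.source) :
    (c.dbaseSymm (c.base x)).comp (c.dbase x) = ContinuousLinearMap.id ℝ _ :=
  c.base_mdiff.symm_comp_deriv hx

theorem dbase_dbaseSymm {u : Eu m} (hu : u ∈ c.base.target) :
    (c.dbase (c.base.symm u)).comp (c.dbaseSymm u) = ContinuousLinearMap.id ℝ _ :=
  c.base_mdiff.comp_symm_deriv hu

theorem proj_mdifferentiableAt {y : E} (hy : y ∈ c.total.source) :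
    MDifferentiableAt (𝓡 (m + n)) (𝓡 m) B.proj y := by
  have h1 : MDifferentiableAt (𝓡 (m + n)) (𝓡 m) (fun y => c.base.symm (c.total y).1) y := by
    have hf : MDifferentiableAt 𝓘(ℝ, Eu m × Eu n) (𝓡 m) (fun z : Eu m × Eu n => z.1)
        (c.total y) := differentiableAt_fst.mdifferentiableAt
    have hb : MDifferentiableAt (𝓡 m) (𝓡 m) c.base.symm (c.total y).1 := by
      refine c.base_mdiff.mdifferentiableAt_symm ?_
      rw [← c.base_proj y hy]
      exact c.base.map_source (c.proj_mem y hy)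
    exact MDifferentiableAt.comp y hb (hf.comp y (c.total_mdiff.mdifferentiableAt hy))
  refine h1.congr_of_eventuallyEq ?_
  filter_upwards [c.total.open_source.mem_nhds hy] with z hz
  rw [← c.base_proj z hz, c.base.left_inv (c.proj_mem z hz)]

theorem dbase_dproj {y : E} (hy : y ∈ c.total.source) :
    (c.dbase (B.proj y)).comp (B.dproj y) =
      (ContinuousLinearMap.fst ℝ (Eu m) (Eu n)).comp (c.dtotal y) := by
  have h1 := mfderiv_comp y (c.base_mdiff.mdifferentiableAt (c.proj_mem y hy))
    (c.proj_mdifferentiableAt hy)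
  have hf : MDifferentiableAt 𝓘(ℝ, Eu m × Eu n) (𝓡 m) (Prod.fst : Eu m × Eu n → Eu m)
      (c.total y) := differentiableAt_fst.mdifferentiableAt
  have h2 := mfderiv_comp y hf (c.total_mdiff.mdifferentiableAt hy)
  have h3 : (c.base ∘ B.proj) =ᶠ[𝓝 y] (Prod.fst ∘ c.total) := by
    filter_upwards [c.total.open_source.mem_nhds hy] with z hz
    exact c.base_proj z hz
  rw [h3.mfderiv_eq, h2] at h1
  have h4 : mfderiv 𝓘(ℝ, Eu m × Eu n) (𝓡 m) (Prod.fst : Eu m × Eu n → Eu m) (c.total y) =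
      ContinuousLinearMap.fst ℝ (Eu m) (Eu n) := by
    rw [mfderiv_eq_fderiv]
    exact fderiv_fst
  rw [h4] at h1
  exact h1.symm

theorem base_symm_fst {z : Eu m × Eu n} (hz : z ∈ c.total.target) :
    B.proj (c.total.symm z) = c.base.symm z.1 := by
  have hy := c.total.map_target hz
  have h := c.base_proj _ hy
  rw [c.total.right_inv hz] at h
  rw [← h, c.base.left_inv (c.proj_mem _ hy)]

end FibredChart

/-- The model space of `J¹π`, with coordinates `(x^α, y^A, v^A_α)`. -/
abbrev J1Model (m n : ℕ) : Type := Eu m × Eu n × (Eu m →L[ℝ] Eu n)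

namespace FibredChart

variable {B} (c c' : B.FibredChart)

/-- The linear map `∂/∂x^α ↦ ∂/∂x^α + v^A_α ∂/∂y^A` at the point with coordinates `z = (x, y)`. -/
def linOf (z : Eu m × Eu n) (v : Eu m →L[ℝ] Eu n) : Eu m →L[ℝ] Eu (m + n) :=
  ((c.dtotalSymm z).comp ((ContinuousLinearMap.id ℝ (Eu m)).prod v)).comp
    (c.dbase (B.proj (c.total.symm z)))

theorem dproj_linOf {z : Eu m × Eu n} (hz : z ∈ c.total.target) (v : Eu m →L[ℝ] Eu n) :
    (B.dproj (c.total.symm z)).comp (c.linOf z v) = ContinuousLinearMap.id ℝ (Eu m) := by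
  have hy := c.total.map_target hz
  have hx := c.proj_mem _ hy
  ext1 a
  have h1 := fun b => DFunLike.congr_fun (c.dbaseSymm_dbase hx) b
  have h2 := fun b => DFunLike.congr_fun (c.dbase_dproj hy) b
  have h3 := fun b => DFunLike.congr_fun (c.dtotal_dtotalSymm hz) b
  simp only [ContinuousLinearMap.comp_apply, ContinuousLinearMap.id_apply,
    ContinuousLinearMap.coe_fst'] at h1 h2 h3
  simp only [linOf, ContinuousLinearMap.comp_apply, ContinuousLinearMap.id_apply]
  rw [← h1 (B.dproj _ _), h2, h3]
  simp only [ContinuousLinearMap.prod_apply, ContinuousLinearMap.id_apply]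
  exact h1 a

/-- The coordinates `v^A_α` of the jet `j`. -/
def velocity (j : B.J1) : Eu m →L[ℝ] Eu n :=
  ((ContinuousLinearMap.snd ℝ (Eu m) (Eu n)).comp (c.dtotal j.pt)).comp
    (j.lin.comp (c.dbaseSymm (c.total j.pt).1))

theorem linOf_velocity {j : B.J1} (hj : j.pt ∈ c.total.source) :
    c.linOf (c.total j.pt) (c.velocity j) = j.lin := by
  have hx := c.proj_mem _ hj
  have h1 := fun b => DFunLike.congr_fun (c.dbaseSymm_dbase hx) b
  have h2 := fun b => DFunLike.congr_fun (c.dbase_dproj hj) b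
  have h3 := fun b => DFunLike.congr_fun (c.dtotalSymm_dtotal hj) b
  have h4 := fun b => DFunLike.congr_fun j.right_inv b
  simp only [ContinuousLinearMap.comp_apply, ContinuousLinearMap.id_apply,
    ContinuousLinearMap.coe_fst'] at h1 h2 h3 h4
  ext1 a
  simp only [linOf, velocity, ContinuousLinearMap.comp_apply, ContinuousLinearMap.prod_apply,
    ContinuousLinearMap.id_apply, c.total.left_inv hj, ContinuousLinearMap.coe_snd',
    ← c.base_proj _ hj, h1]
  have h5 : (c.dbase (B.proj j.pt) a, (c.dtotal j.pt (j.lin a)).2) = c.dtotal j.pt (j.lin a) :=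
    Prod.ext (by rw [← h2, h4]) rfl
  rw [h5, h3]

theorem velocity_linOf {z : Eu m × Eu n} (hz : z ∈ c.total.target) (v : Eu m →L[ℝ] Eu n) :
    c.velocity ⟨c.total.symm z, c.linOf z v, c.dproj_linOf hz v⟩ = v := by
  have hy := c.total.map_target hz
  have hu : z.1 ∈ c.base.target := by
    have h := c.base.map_source (c.proj_mem _ hy)
    rwa [c.base_proj _ hy, c.total.right_inv hz] at h
  have h3 := fun b => DFunLike.congr_fun (c.dtotal_dtotalSymm hz) b
  have h4 := fun b => DFunLike.congr_fun (c.dbase_dbaseSymm hu) b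
  simp only [ContinuousLinearMap.comp_apply, ContinuousLinearMap.id_apply] at h3 h4
  ext1 a
  simp only [linOf, velocity, ContinuousLinearMap.comp_apply, ContinuousLinearMap.prod_apply,
    ContinuousLinearMap.id_apply, c.total.right_inv hz, ContinuousLinearMap.coe_snd', h3,
    c.base_symm_fst hz, h4]

open Classical in
/-- The natural chart `j ↦ (x^α, y^A, v^A_α)` of `J¹π` induced by a fibred chart
(`j₀` only provides values of the inverse outside of its domain). -/
def natChart (j₀ : B.J1) : PartialEquiv B.J1 (J1Model m n) where
  toFun j := ((c.total j.pt).1, (c.total j.pt).2, c.velocity j)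
  invFun w := if h : (w.1, w.2.1) ∈ c.total.target then
    ⟨c.total.symm (w.1, w.2.1), c.linOf (w.1, w.2.1) w.2.2, c.dproj_linOf h w.2.2⟩ else j₀
  source := {j | j.pt ∈ c.total.source}
  target := {w | (w.1, w.2.1) ∈ c.total.target}
  map_source' j hj := c.total.map_source hj
  map_target' w hw := by
    have hw' : (w.1, w.2.1) ∈ c.total.target := hw
    rw [dif_pos hw']
    exact c.total.map_target hw'
  left_inv' j hj := by
    have h := c.total.map_source hj
    have h' : ((c.total j.pt).1, (c.total j.pt).2) ∈ c.total.target := h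
    rw [dif_pos h']
    have e1 := c.total.left_inv hj
    have e2 := c.linOf_velocity hj
    cases j
    simp only [Prod.mk.eta, J1.mk.injEq]
    exact ⟨e1, e2⟩
  right_inv' w hw := by
    have hw' : (w.1, w.2.1) ∈ c.total.target := hw
    rw [dif_pos hw']
    refine Prod.ext ?_ (Prod.ext ?_ ?_)
    · simp only [c.total.right_inv hw']
    · simp only [c.total.right_inv hw']
    · exact c.velocity_linOf hw' w.2.2

theorem natChart_symm_apply (j₀ : B.J1) {w : J1Model m n} (hw : (w.1, w.2.1) ∈ c.total.target) :
    (c.natChart j₀).symm w =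
      ⟨c.total.symm (w.1, w.2.1), c.linOf (w.1, w.2.1) w.2.2, c.dproj_linOf hw w.2.2⟩ :=
  dif_pos hw

theorem mem_trans_source (j₀ j₁ : B.J1) (w : J1Model m n) :
    w ∈ ((c.natChart j₀).symm.trans (c'.natChart j₁)).source ↔
      (w.1, w.2.1) ∈ (c.total.symm.trans c'.total).source := by
  rw [PartialEquiv.trans_source, OpenPartialHomeomorph.trans_source]
  constructor
  · rintro ⟨h1, h2⟩
    have h1' : (w.1, w.2.1) ∈ c.total.target := h1
    rw [mem_preimage, c.natChart_symm_apply j₀ h1'] at h2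
    exact ⟨h1, h2⟩
  · rintro ⟨h1, h2⟩
    refine ⟨h1, ?_⟩
    have h1' : (w.1, w.2.1) ∈ c.total.target := h1
    rw [mem_preimage, c.natChart_symm_apply j₀ h1']
    exact h2

theorem isOpen_trans_source (j₀ j₁ : B.J1) :
    IsOpen ((c.natChart j₀).symm.trans (c'.natChart j₁)).source := by
  have h : ((c.natChart j₀).symm.trans (c'.natChart j₁)).source =
      (fun w : J1Model m n => (w.1, w.2.1)) ⁻¹' (c.total.symm.trans c'.total).source :=
    Set.ext fun w => c.mem_trans_source c' j₀ j₁ w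
  rw [h]
  exact (c.total.symm.trans c'.total).open_source.preimage (by fun_prop)

theorem total_trans_contDiffOn :
    ContDiffOn ℝ ∞ (c'.total ∘ c.total.symm) (c.total.symm.trans c'.total).source := by
  rw [← contMDiffOn_iff_contDiffOn]
  rw [OpenPartialHomeomorph.trans_source]
  exact c'.total_smooth.comp (c.total_symm_smooth.mono fun z hz => hz.1) fun z hz => hz.2

theorem base_trans_contDiffOn :
    ContDiffOn ℝ ∞ (c'.base ∘ c.base.symm) (c.base.symm.trans c'.base).source := by
  rw [← contMDiffOn_iff_contDiffOn]
  rw [OpenPartialHomeomorph.trans_source]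
  exact c'.base_smooth.comp (c.base_symm_smooth.mono fun z hz => hz.1) fun z hz => hz.2

theorem fderiv_total_trans {z : Eu m × Eu n} (hz : z ∈ (c.total.symm.trans c'.total).source) :
    fderiv ℝ (c'.total ∘ c.total.symm) z =
      (c'.dtotal (c.total.symm z)).comp (c.dtotalSymm z) := by
  rw [OpenPartialHomeomorph.trans_source] at hz
  rw [← mfderiv_eq_fderiv]
  exact mfderiv_comp z (c'.total_mdiff.mdifferentiableAt hz.2)
    (c.total_mdiff.mdifferentiableAt_symm hz.1)

theorem fderiv_base_trans {u : Eu m} (hu : u ∈ (c.base.symm.trans c'.base).source) :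
    fderiv ℝ (c'.base ∘ c.base.symm) u =
      (c'.dbase (c.base.symm u)).comp (c.dbaseSymm u) := by
  rw [OpenPartialHomeomorph.trans_source] at hu
  rw [← mfderiv_eq_fderiv]
  exact mfderiv_comp u (c'.base_mdiff.mdifferentiableAt hu.2)
    (c.base_mdiff.mdifferentiableAt_symm hu.1)

/-- The changes of natural coordinates are smooth. -/
theorem natChart_trans_contDiffOn (j₀ j₁ : B.J1) :
    ContDiffOn ℝ ∞ ((c.natChart j₀).symm.trans (c'.natChart j₁))
      ((c.natChart j₀).symm.trans (c'.natChart j₁)).source := by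
  set S := ((c.natChart j₀).symm.trans (c'.natChart j₁)).source with hS
  set T : Eu m × Eu n → Eu m × Eu n := c'.total ∘ c.total.symm with hT
  set R : Eu m → Eu m := c.base ∘ c'.base.symm with hR
  have hp : ContDiffOn ℝ ∞ (fun w : J1Model m n => (w.1, w.2.1)) S :=
    (contDiff_fst.prodMk (contDiff_fst.comp contDiff_snd)).contDiffOn
  have hmaps : ∀ w ∈ S, (w.1, w.2.1) ∈ (c.total.symm.trans c'.total).source :=
    fun w hw => (c.mem_trans_source c' j₀ j₁ w).1 hw
  have h1 : ContDiffOn ℝ ∞ (fun w : J1Model m n => T (w.1, w.2.1)) S :=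
    (c.total_trans_contDiffOn c').comp hp hmaps
  have h2 : ContDiffOn ℝ ∞ (fun w : J1Model m n => fderiv ℝ T (w.1, w.2.1)) S :=
    ((c.total_trans_contDiffOn c').fderiv_of_isOpen
      (c.total.symm.trans c'.total).open_source (by simp)).comp hp hmaps
  have hmaps' : ∀ w ∈ S, (T (w.1, w.2.1)).1 ∈ (c'.base.symm.trans c.base).source := by
    intro w hw
    have hz := hmaps w hw
    rw [OpenPartialHomeomorph.trans_source] at hz
    have hb := c'.base_proj _ hz.2
    rw [OpenPartialHomeomorph.trans_source]
    have e : (T (w.1, w.2.1)).1 = c'.base (B.proj (c.total.symm (w.1, w.2.1))) := hb.symm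
    rw [e]
    refine ⟨c'.base.map_source (c'.proj_mem _ hz.2), ?_⟩
    rw [mem_preimage, c'.base.left_inv (c'.proj_mem _ hz.2)]
    exact c.proj_mem _ (c.total.map_target hz.1)
  have h3 : ContDiffOn ℝ ∞ (fun w : J1Model m n => fderiv ℝ R (T (w.1, w.2.1)).1) S :=
    ((c'.base_trans_contDiffOn c).fderiv_of_isOpen
      (c'.base.symm.trans c.base).open_source (by simp)).comp
      (contDiff_fst.comp_contDiffOn h1) hmaps'
  have hv : ContDiffOn ℝ ∞
      (fun w : J1Model m n => (ContinuousLinearMap.inl ℝ (Eu m) (Eu n)) +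
        (ContinuousLinearMap.inr ℝ (Eu m) (Eu n)).comp w.2.2) S :=
    (contDiff_const.add (contDiff_const.clm_comp
      (contDiff_snd.comp contDiff_snd))).contDiffOn
  have h4 : ContDiffOn ℝ ∞ (fun w : J1Model m n =>
      (((ContinuousLinearMap.snd ℝ (Eu m) (Eu n)).comp (fderiv ℝ T (w.1, w.2.1))).comp
        ((ContinuousLinearMap.inl ℝ (Eu m) (Eu n)) +
        (ContinuousLinearMap.inr ℝ (Eu m) (Eu n)).comp w.2.2)).comp
        (fderiv ℝ R (T (w.1, w.2.1)).1)) S :=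
    (((contDiffOn_const.clm_comp h2).clm_comp hv).clm_comp h3)
  have h5 : ContDiffOn ℝ ∞ (fun w : J1Model m n => ((T (w.1, w.2.1)).1, (T (w.1, w.2.1)).2,
      (((ContinuousLinearMap.snd ℝ (Eu m) (Eu n)).comp (fderiv ℝ T (w.1, w.2.1))).comp
        ((ContinuousLinearMap.inl ℝ (Eu m) (Eu n)) +
        (ContinuousLinearMap.inr ℝ (Eu m) (Eu n)).comp w.2.2)).comp
        (fderiv ℝ R (T (w.1, w.2.1)).1))) S :=
    (contDiff_fst.comp_contDiffOn h1).prodMk ((contDiff_snd.comp_contDiffOn h1).prodMk h4)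
  refine h5.congr fun w hw => ?_
  have hz := hmaps w hw
  have hz' := hmaps' w hw
  have e2 := c.fderiv_total_trans c' hz
  have e3 := c'.fderiv_base_trans c hz'
  rw [OpenPartialHomeomorph.trans_source] at hz
  have hzt : (w.1, w.2.1) ∈ c.total.target := hz.1
  have e4 : c'.base.symm (T (w.1, w.2.1)).1 = B.proj (c.total.symm (w.1, w.2.1)) := by
    have hb := c'.base_proj _ hz.2
    have e : (T (w.1, w.2.1)).1 = c'.base (B.proj (c.total.symm (w.1, w.2.1))) := hb.symm
    rw [e, c'.base.left_inv (c'.proj_mem _ hz.2)]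
  rw [PartialEquiv.coe_trans, Function.comp_apply, c.natChart_symm_apply j₀ hzt]
  refine Prod.ext rfl (Prod.ext rfl ?_)
  rw [hT, e2, hR, e3, ← hT, e4]
  ext1 a
  simp only [natChart, velocity, linOf, ContinuousLinearMap.comp_apply,
    add_apply, ContinuousLinearMap.prod_apply, ContinuousLinearMap.id_apply,
    ContinuousLinearMap.inl_apply, ContinuousLinearMap.inr_apply, Prod.mk_add_mk, add_zero,
    zero_add]
  rfl

end FibredChart

/-- The atlas of natural charts of `J¹π`. -/
def j1Core : ChartedSpaceCore (J1Model m n) B.J1 where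
  atlas := {e | ∃ (c : B.FibredChart) (j₀ : B.J1), e = c.natChart j₀}
  chartAt j := (B.exists_fibredChart j.pt).choose.natChart j
  mem_chart_source j := (B.exists_fibredChart j.pt).choose_spec
  chart_mem_atlas j := ⟨_, _, rfl⟩
  open_source := by
    rintro e e' ⟨c, j₀, rfl⟩ ⟨c', j₁, rfl⟩
    exact c.isOpen_trans_source c' j₀ j₁
  continuousOn_toFun := by
    rintro e e' ⟨c, j₀, rfl⟩ ⟨c', j₁, rfl⟩
    exact (c.natChart_trans_contDiffOn c' j₀ j₁).continuousOn

instance instTopologicalSpaceJ1 : TopologicalSpace B.J1 := B.j1Core.toTopologicalSpace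

instance instChartedSpaceJ1 : ChartedSpace (J1Model m n) B.J1 := B.j1Core.toChartedSpace

instance instIsManifoldJ1 : IsManifold 𝓘(ℝ, J1Model m n) ∞ B.J1 := by
  refine isManifold_of_contDiffOn _ _ _ fun e e' he he' => ?_
  obtain ⟨_, he⟩ := mem_iUnion.1 he
  obtain ⟨⟨c, j₀, rfl⟩, he⟩ := mem_iUnion.1 he
  obtain ⟨_, he'⟩ := mem_iUnion.1 he'
  obtain ⟨⟨c', j₁, rfl⟩, he'⟩ := mem_iUnion.1 he'
  rw [mem_singleton_iff] at he he'
  subst he he'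
  exact (c.natChart_trans_contDiffOn c' j₀ j₁).mono fun w hw => hw.1


section Lagrangian

variable {B}

/-- The tangent map `T_j π¹ : T_j J¹π → T_y E`. -/
def J1.dpt (j : B.J1) : TangentSpace 𝓘(ℝ, J1Model m n) j →L[ℝ] Eu (m + n) :=
  mfderiv 𝓘(ℝ, J1Model m n) (𝓡 (m + n)) (J1.pt : B.J1 → E) j

/-- The tangent map `T_j π̄¹ = T_y π ∘ T_j π¹ : T_j J¹π → T_x M` of `π̄¹ = π ∘ π¹`. -/
def J1.dbar (j : B.J1) : TangentSpace 𝓘(ℝ, J1Model m n) j →L[ℝ] Eu m :=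
  (B.dproj j.pt).comp j.dpt

/-- The space `T_x^* M ⊗ V_y(π)` of linear maps from `T_x M` to the vertical subspace of `T_y E`,
on which the fibre of `π¹ : J¹π → E` through `j` is modelled as an affine space. -/
def J1.VHom (j : B.J1) : Submodule ℝ (Eu m →L[ℝ] Eu (m + n)) where
  carrier := {k | (B.dproj j.pt).comp k = 0}
  add_mem' {a b} ha hb := by
    change (B.dproj j.pt).comp (a + b) = 0
    rw [ContinuousLinearMap.comp_add, show (B.dproj j.pt).comp a = 0 from ha,
      show (B.dproj j.pt).comp b = 0 from hb, add_zero]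
  zero_mem' := ContinuousLinearMap.comp_zero _
  smul_mem' c a ha := by
    change (B.dproj j.pt).comp (c • a) = 0
    rw [ContinuousLinearMap.comp_smul, show (B.dproj j.pt).comp a = 0 from ha]
    exact smul_zero (A := Eu m →L[ℝ] Eu m) c

/-- The affine structure `j ↦ j + k` of the fibres of `π¹ : J¹π → E`. -/
def J1.addVert (j : B.J1) (k : j.VHom) : B.J1 where
  pt := j.pt
  lin := j.lin + k
  right_inv := by
    have hk : (B.dproj j.pt).comp (k : Eu m →L[ℝ] Eu (m + n)) = 0 := k.2
    rw [ContinuousLinearMap.comp_add, j.right_inv, hk, add_zero]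

theorem J1.addVert_zero (j : B.J1) : j.addVert 0 = j := by
  cases j
  simp [J1.addVert]

/-- The vertical lift `T_x^* M ⊗ V_y(π) ≅ V_j(π¹) ⊆ T_j J¹π`: the tangent map at `0` of
`k ↦ j + k`. -/
def J1.vertLift (j : B.J1) : j.VHom →L[ℝ] TangentSpace 𝓘(ℝ, J1Model m n) j :=
  mfderiv 𝓘(ℝ, j.VHom) 𝓘(ℝ, J1Model m n) j.addVert 0

/-- The structure form of `J¹π`, `θ_j(Z) = T_j π¹(Z) - j(T_j π̄¹(Z))`, with values in `V_y(π)`;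
in natural coordinates it is `(dy^A - v^A_α dx^α) ⊗ ∂/∂y^A`. -/
def J1.structureForm (j : B.J1) : TangentSpace 𝓘(ℝ, J1Model m n) j →L[ℝ] Eu (m + n) :=
  j.dpt - j.lin.comp j.dbar

theorem J1.dproj_structureForm (j : B.J1) (Z : TangentSpace 𝓘(ℝ, J1Model m n) j) :
    B.dproj j.pt (j.structureForm Z) = 0 := by
  have h := DFunLike.congr_fun j.right_inv (j.dbar Z)
  simp only [ContinuousLinearMap.comp_apply, ContinuousLinearMap.id_apply] at h
  simp only [J1.structureForm, sub_apply, map_sub, ContinuousLinearMap.comp_apply, h]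
  simp [J1.dbar]

/-- `β ⊗ θ_j(Z)`, as an element of `T_x^* M ⊗ V_y(π)`. -/
def J1.tensorVert (j : B.J1) (Z : TangentSpace 𝓘(ℝ, J1Model m n) j)
    (β : Module.Dual ℝ (Eu m)) : j.VHom :=
  ⟨(LinearMap.toContinuousLinearMap β).smulRight (j.structureForm Z), by
    change (B.dproj j.pt).comp _ = 0
    ext1 a
    simp [J1.dproj_structureForm]⟩

theorem J1.tensorVert_add_left (j : B.J1) (Z Z' : TangentSpace 𝓘(ℝ, J1Model m n) j)
    (β : Module.Dual ℝ (Eu m)) :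
    j.tensorVert (Z + Z') β = j.tensorVert Z β + j.tensorVert Z' β := by
  apply Subtype.ext
  ext1 a
  change β a • j.structureForm (Z + Z') = β a • j.structureForm Z + β a • j.structureForm Z'
  rw [map_add, smul_add]

theorem J1.tensorVert_smul_left (j : B.J1) (c : ℝ) (Z : TangentSpace 𝓘(ℝ, J1Model m n) j)
    (β : Module.Dual ℝ (Eu m)) : j.tensorVert (c • Z) β = c • j.tensorVert Z β := by
  apply Subtype.ext
  ext1 a
  change β a • j.structureForm (c • Z) = c • (β a • j.structureForm Z)
  rw [map_smul, smul_comm]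

theorem J1.tensorVert_add_right (j : B.J1) (Z : TangentSpace 𝓘(ℝ, J1Model m n) j)
    (β β' : Module.Dual ℝ (Eu m)) :
    j.tensorVert Z (β + β') = j.tensorVert Z β + j.tensorVert Z β' := by
  apply Subtype.ext
  ext1 a
  exact add_smul (β a) (β' a) (j.structureForm Z)

theorem J1.tensorVert_smul_right (j : B.J1) (c : ℝ) (Z : TangentSpace 𝓘(ℝ, J1Model m n) j)
    (β : Module.Dual ℝ (Eu m)) : j.tensorVert Z (c • β) = c • j.tensorVert Z β := by
  apply Subtype.ext
  ext1 a
  exact mul_smul c (β a) (j.structureForm Z)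

/-- The vertical endomorphism `𝒱` of `J¹π`, a section of `T^*J¹π ⊗ V(π¹) ⊗ TM`, as the bilinear
map `𝒱_j(Z, β) = vertical lift of β ⊗ θ_j(Z)` for `Z ∈ T_j J¹π` and `β ∈ T_x^* M`; in natural
coordinates it is `(dy^A - v^A_α dx^α) ⊗ ∂/∂v^A_ν ⊗ ∂/∂x^ν`. -/
def J1.vertEndo (j : B.J1) : TangentSpace 𝓘(ℝ, J1Model m n) j →ₗ[ℝ] Module.Dual ℝ (Eu m) →ₗ[ℝ]
    TangentSpace 𝓘(ℝ, J1Model m n) j :=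
  LinearMap.mk₂ ℝ (fun Z β => j.vertLift (j.tensorVert Z β))
    (fun Z Z' β => by rw [j.tensorVert_add_left, map_add])
    (fun c Z β => by rw [j.tensorVert_smul_left, map_smul])
    (fun Z β β' => by rw [j.tensorVert_add_right, map_add])
    (fun c Z β => by rw [j.tensorVert_smul_right, map_smul])

/-- The differential of `L : J¹π → ℝ`. -/
def J1.dL (j : B.J1) (L : B.J1 → ℝ) : TangentSpace 𝓘(ℝ, J1Model m n) j →L[ℝ] ℝ :=
  mfderiv 𝓘(ℝ, J1Model m n) 𝓘(ℝ, ℝ) L j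

/-- The contraction of the factor `V(π¹)` of `𝒱` with `dL`: a section of `T^*J¹π ⊗ TM`, in natural
coordinates `∂L/∂v^A_ν (dy^A - v^A_α dx^α) ⊗ ∂/∂x^ν`. -/
def J1.vertEndoContract (j : B.J1) (L : B.J1 → ℝ) :
    TangentSpace 𝓘(ℝ, J1Model m n) j →L[ℝ] Eu m where
  toLinearMap := (Module.evalEquiv ℝ (Eu m)).symm.toLinearMap ∘ₗ
    j.vertEndo.compr₂ (j.dL L).toLinearMap
  cont := by
    have : FiniteDimensional ℝ (TangentSpace 𝓘(ℝ, J1Model m n) j) :=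
      inferInstanceAs (FiniteDimensional ℝ (J1Model m n))
    have : T2Space (TangentSpace 𝓘(ℝ, J1Model m n) j) := inferInstanceAs (T2Space (J1Model m n))
    exact LinearMap.continuous_of_finiteDimensional _

variable (η : (x : M) → TangentSpace (𝓡 m) x [⋀^Fin m]→L[ℝ] ℝ) (L : B.J1 → ℝ)

/-- `ω = π̄¹^* η`. -/
def volPullback (j : B.J1) : TangentSpace 𝓘(ℝ, J1Model m n) j [⋀^Fin m]→L[ℝ] ℝ :=
  (η (B.proj j.pt)).compContinuousLinearMap j.dbar

/-- The Poincaré–Cartan `m`-form `Θ_ℒ = i(𝒱)ℒ + ℒ` of the Lagrangian density `ℒ = L ω`; in natural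
coordinates with `ω = dᵐx` it is
`∂L/∂v^A_α (dy^A - v^A_ν dx^ν) ∧ d^{m-1}x_α + L dᵐx`. -/
def thetaL (j : B.J1) : TangentSpace 𝓘(ℝ, J1Model m n) j [⋀^Fin m]→L[ℝ] ℝ :=
  tensorContract (j.vertEndoContract L) j.dbar (η (B.proj j.pt)) + L j • volPullback η j

/-- The Poincaré–Cartan `(m+1)`-form `Ω_ℒ = -dΘ_ℒ`. -/
def omegaL (j : B.J1) : TangentSpace 𝓘(ℝ, J1Model m n) j [⋀^Fin (m + 1)]→L[ℝ] ℝ :=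
  -manifoldExtDeriv (thetaL η L) j

/-- The Hessian of `L` along the fibre of `π¹` through `j`; in natural coordinates it has the
matrix `∂²L/∂v^A_α ∂v^B_ν`. -/
def fibreHessian (j : B.J1) (k₁ k₂ : j.VHom) : ℝ :=
  deriv (fun s : ℝ => deriv (fun t : ℝ => L (j.addVert (s • k₁ + t • k₂))) 0) 0

/-- The Lagrangian system is regular: `Ω_ℒ` is `1`-nondegenerate or `∂²L/∂v^A_α ∂v^B_ν` is a
nonsingular matrix at every point. The first condition implies the second, and they are
equivalent if `m ≥ 2` and `n ≥ 1`. If `m = 1` then the `2`-form `Ω_ℒ` is `1`-degenerate at every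
point, as `dim J¹π = 2n + 1` is odd, and the second condition is the usual notion of regularity. -/
def IsRegularLagrangian : Prop :=
  (∀ j : B.J1, IsOneNondegenerate (omegaL η L j)) ∨
    (∀ (j : B.J1) (k₁ : j.VHom), (∀ k₂ : j.VHom, fibreHessian L j k₁ k₂ = 0) → k₁ = 0)

variable (X : (j : B.J1) → ⋀[ℝ]^m (TangentSpace 𝓘(ℝ, J1Model m n) j))

/-- The `m`-vector field `X` is semi-holonomic: `i(X)𝒱 = 0`. Here `X` is contracted with the factor
`T^*J¹π` of `𝒱`, that is, `i(a)X = 0` for all the components `a = ζ(𝒱(·, β))` of `𝒱`,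
where `i(a)(Y₁ ∧ … ∧ Y_m) = ∑ᵢ (-1)^(i-1) a(Yᵢ) Y₁ ∧ … Ŷᵢ … ∧ Y_m`. -/
def IsSemiHolonomic : Prop :=
  ∀ (j : B.J1) (β : Module.Dual ℝ (Eu m)) (ζ : Module.Dual ℝ (TangentSpace 𝓘(ℝ, J1Model m n) j)),
    CliffordAlgebra.contractLeft (Q := (0 : QuadraticForm ℝ (TangentSpace 𝓘(ℝ, J1Model m n) j)))
      (ζ ∘ₗ j.vertEndo.flip β)
      (X j : ExteriorAlgebra ℝ (TangentSpace 𝓘(ℝ, J1Model m n) j)) = 0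

/-- Euler–Lagrange `m`-vector fields: semi-holonomic locally decomposable solutions of
`i(X)Ω_ℒ = 0`. -/
structure IsEulerLagrange : Prop where
  locallyDecomposable : IsLocallyDecomposable X
  semiHolonomic : IsSemiHolonomic X
  contract_eq_zero : ∀ j, mvContract (X j) (omegaL η L j) = 0

end Lagrangian

end SmoothFibreBundle

end

/-!
In natural coordinates the contraction of `Ω_ℒ` with a vertical vector `k^A_α ∂/∂v^A_α` is, up to
sign, `∂²L/∂v^A_α∂v^B_ν k^A_α (dy^B - v^B_μ dx^μ) ∧ i(∂/∂x^ν) ω`: the contact forms are hit only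
through the momenta, since the derivative of their coefficients `v^A_α` cancels the derivative of
`L ω`. On `Y₁ ∧ … ∧ Y_m` with `ω(Y₁, …, Y_m) ≠ 0` the `Yᵢ` project to a basis of the tangent space
of `M`, so there is a unique linear map `G` with `G(dx(Yᵢ)) = (dy - v dx)(Yᵢ)`, and this contraction
equals, up to sign, the Hessian of `L` at `(k, G)` times `ω(Y₁, …, Y_m)`. If all of them vanish, `G`
is in the kernel of the Hessian, hence zero by regularity, and the contact forms vanish on the `Yᵢ`.
-/

set_option maxSynthPendingDepth 3

noncomputable section

section LinearAlgebra

variable {R M N : Type*} [CommRing R] [AddCommGroup M] [Module R M] [AddCommGroup N] [Module R N]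

theorem sum_map_update_basis_eq_trace_smul {ι : Type*} [Fintype ι] [DecidableEq ι]
    (b : Module.Basis ι R M) (f : M [⋀^ι]→ₗ[R] N) (Q : M →ₗ[R] M) :
    ∑ i, f (Function.update b i (Q (b i))) = LinearMap.trace R M Q • f b := by
  have hcoord (i : ι) : f (Function.update b i (Q (b i))) = b.repr (Q (b i)) i • f b := by
    conv_lhs => rw [← b.sum_repr (Q (b i))]
    rw [f.map_update_sum, Finset.sum_eq_single i, f.map_update_smul, Function.update_eq_self]
    · intro j _ hj
      rw [f.map_update_smul, f.map_update_self b hj.symm, smul_zero]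
    · simp
  simp only [hcoord, ← Finset.sum_smul, LinearMap.trace_eq_matrix_trace R b, Matrix.trace,
    Matrix.diag_apply, LinearMap.toMatrix_apply]

theorem contractLeft_ιMulti_eq_zero (d : Module.Dual R M) {m : ℕ} (Y : Fin m → M)
    (hY : ∀ i, d (Y i) = 0) :
    CliffordAlgebra.contractLeft (Q := (0 : QuadraticForm R M)) d
      (ExteriorAlgebra.ιMulti R m Y : ExteriorAlgebra R M) = 0 := by
  induction m with
  | zero =>
    rw [ExteriorAlgebra.ιMulti_zero_apply]
    exact CliffordAlgebra.contractLeft_one 0 d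
  | succ m ih =>
    rw [ExteriorAlgebra.ιMulti_succ_apply]
    refine (CliffordAlgebra.contractLeft_ι_mul d _ _).trans ?_
    rw [hY 0, zero_smul, zero_sub, neg_eq_zero]
    exact (congrArg _ (ih (Matrix.vecTail Y) fun i => hY i.succ)).trans (mul_zero _)

variable {m : ℕ} {V W : Type*} [AddCommGroup V] [Module ℝ V] [TopologicalSpace V]
  [AddCommGroup W] [Module ℝ W] [TopologicalSpace W]

theorem mvPair_ιMulti (Y : Fin m → V) (α : V [⋀^Fin m]→L[ℝ] ℝ) :
    mvPair (exteriorPower.ιMulti ℝ m Y) α = α Y :=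
  exteriorPower.alternatingMapLinearEquiv_apply_ιMulti _ _

theorem mvContract_ιMulti (Y : Fin m → V) (Ω : V [⋀^Fin (m + 1)]→L[ℝ] ℝ) (w : V) :
    mvContract (exteriorPower.ιMulti ℝ m Y) Ω w = (-1 : ℝ) ^ m * Ω (Fin.cons w Y) := by
  change (-1 : ℝ) ^ m * exteriorPower.alternatingMapLinearEquiv
    (Ω.toAlternatingMap.curryLeft w) (exteriorPower.ιMulti ℝ m Y) = _
  rw [exteriorPower.alternatingMapLinearEquiv_apply_ιMulti]
  rfl

theorem tensorContract_apply (P T : V →L[ℝ] W) (η : W [⋀^Fin m]→L[ℝ] ℝ) (Z : Fin m → V) :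
    tensorContract P T η Z = ∑ i, η (Function.update (T ∘ Z) i (P (Z i))) := rfl

theorem tensorContract_comp_eq_trace_smul [FiniteDimensional ℝ W]
    (hW : Module.finrank ℝ W = m) (Q : W →L[ℝ] W) (T : V →L[ℝ] W) (η : W [⋀^Fin m]→L[ℝ] ℝ) :
    tensorContract (Q.comp T) T η =
      LinearMap.trace ℝ W Q.toLinearMap • η.compContinuousLinearMap T := by
  let b := Module.finBasisOfFinrankEq ℝ W hW
  have hid : (tensorContract Q (ContinuousLinearMap.id ℝ W) η).toAlternatingMap =
      LinearMap.trace ℝ W Q.toLinearMap • η.toAlternatingMap := by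
    refine b.ext_alternating fun σ hσ => ?_
    let τ : Equiv.Perm (Fin m) := Equiv.ofBijective σ (Finite.injective_iff_bijective.1 hσ)
    have hτ : ⇑(b.reindex τ.symm) = fun i => b (σ i) := funext fun i => by simp [τ]
    have htrace := sum_map_update_basis_eq_trace_smul (b.reindex τ.symm) η.toAlternatingMap
      Q.toLinearMap
    rwa [hτ] at htrace
  exact ContinuousAlternatingMap.ext fun Z => DFunLike.congr_fun hid (T ∘ Z)

end LinearAlgebra

section Calculus

variable {H V W : Type*} [NormedAddCommGroup H] [NormedSpace ℝ H] [NormedAddCommGroup V]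
  [NormedSpace ℝ V] [NormedAddCommGroup W] [NormedSpace ℝ W]

instance finiteDimensional_continuousAlternatingMap {ι : Type*} [Finite ι]
    [FiniteDimensional ℝ V] [FiniteDimensional ℝ W] :
    FiniteDimensional ℝ (V [⋀^ι]→L[ℝ] W) :=
  Module.Finite.of_injective
    (AlternatingMap.toMultilinearMapLM ∘ₗ
      ContinuousAlternatingMap.toAlternatingMapLinear (R := ℝ) (A := ℝ) (M := V) (N := W) (ι := ι))
    fun _ _ h => ContinuousAlternatingMap.ext fun Z => DFunLike.congr_fun h Z

theorem tensorContract_eq_fderivCompContinuousLinearMap {m : ℕ} (P T : V →L[ℝ] W)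
    (η : W [⋀^Fin m]→L[ℝ] ℝ) :
    tensorContract P T η = η.fderivCompContinuousLinearMap T P := by
  ext Z
  rw [tensorContract_apply, ContinuousAlternatingMap.fderivCompContinuousLinearMap_apply]
  refine Finset.sum_congr rfl fun i _ => congrArg η (funext fun j => ?_)
  rcases eq_or_ne j i with rfl | hji
  · simp
  · simp [hji]

theorem differentiableAt_tensorContract [FiniteDimensional ℝ W] {m : ℕ} {P : H → V →L[ℝ] W}
    {η : H → W [⋀^Fin m]→L[ℝ] ℝ} {x : H} (hP : DifferentiableAt ℝ P x)
    (hη : DifferentiableAt ℝ η x) (T : V →L[ℝ] W) :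
    DifferentiableAt ℝ (fun y => tensorContract (P y) T (η y)) x := by
  let Φ : (W [⋀^Fin m]→L[ℝ] ℝ) →L[ℝ] (V →L[ℝ] W) →L[ℝ] V [⋀^Fin m]→L[ℝ] ℝ :=
    LinearMap.toContinuousLinearMap
      { toFun := fun η : W [⋀^Fin m]→L[ℝ] ℝ => η.fderivCompContinuousLinearMap T
        map_add' := fun η η' => by ext; simp [Finset.sum_add_distrib]
        map_smul' := fun a η => by ext; simp [Finset.mul_sum] }
  simp only [tensorContract_eq_fderivCompContinuousLinearMap]
  exact (Φ.hasFDerivAt_of_bilinear hη.hasFDerivAt hP.hasFDerivAt).differentiableAt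

theorem differentiableAt_fderiv_of_contDiffAt_two {f : V → W} {x : V} (hf : ContDiffAt ℝ 2 f x) :
    DifferentiableAt ℝ (fderiv ℝ f) x :=
  (hf.fderiv_right (m := 1) (by norm_num)).differentiableAt (by norm_num)

theorem deriv_deriv_eq_fderiv_fderiv {f : V → W} {x : V} (hf : ContDiffAt ℝ 2 f x) (a b : V) :
    deriv (fun s : ℝ => deriv (fun t : ℝ => f (x + (s • a + t • b))) 0) 0 =
      fderiv ℝ (fderiv ℝ f) x a b := by
  have hf' := differentiableAt_fderiv_of_contDiffAt_two hf
  have hline : Filter.Tendsto (fun s : ℝ => x + s • a) (𝓝 0) (𝓝 x) :=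
    Continuous.tendsto' (by fun_prop) _ _ (by simp)
  have hinner : (fun s : ℝ => deriv (fun t : ℝ => f (x + (s • a + t • b))) 0) =ᶠ[𝓝 0]
      fun s => fderiv ℝ f (x + s • a) b := by
    filter_upwards [hline.eventually (hf.eventually (by simp))] with s hs
    simp only [← add_assoc]
    exact (hs.differentiableAt (by norm_num)).lineDeriv_eq_fderiv
  rw [hinner.deriv_eq]
  exact (((ContinuousLinearMap.apply ℝ W b).hasFDerivAt.comp x
    hf'.hasFDerivAt).hasLineDerivAt a).lineDeriv

end Calculus

section NaturalCoordinates

variable {X Y : Type*} [NormedAddCommGroup X] [NormedSpace ℝ X] [NormedAddCommGroup Y]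
  [NormedSpace ℝ Y]

variable (X Y) in
/-- The inclusion of the velocities, `∂/∂v^A_α`, in the coordinates `(x^α, y^A, v^A_α)`. -/
def vertIncl : (X →L[ℝ] Y) →L[ℝ] X × Y × (X →L[ℝ] Y) :=
  (ContinuousLinearMap.inr ℝ X (Y × (X →L[ℝ] Y))).comp (ContinuousLinearMap.inr ℝ Y (X →L[ℝ] Y))

variable (X Y) in
/-- The projection `dx` to the base in the coordinates `(x^α, y^A, v^A_α)`. -/
def baseProj : X × Y × (X →L[ℝ] Y) →L[ℝ] X :=
  ContinuousLinearMap.fst ℝ X (Y × (X →L[ℝ] Y))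

/-- The contact forms `dy^A - v^A_α dx^α` at velocity `v`. -/
def contactForm (v : X →L[ℝ] Y) : X × Y × (X →L[ℝ] Y) →L[ℝ] Y :=
  (ContinuousLinearMap.fst ℝ Y (X →L[ℝ] Y)).comp
    (ContinuousLinearMap.snd ℝ X (Y × (X →L[ℝ] Y))) - v.comp (baseProj X Y)

theorem vertIncl_apply (k : X →L[ℝ] Y) : vertIncl X Y k = (0, 0, k) := rfl

theorem baseProj_apply (w : X × Y × (X →L[ℝ] Y)) : baseProj X Y w = w.1 := rfl

theorem contactForm_apply (v : X →L[ℝ] Y) (w : X × Y × (X →L[ℝ] Y)) :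
    contactForm v w = w.2.1 - v w.1 := rfl

theorem contactForm_vertIncl (v k : X →L[ℝ] Y) : contactForm v (vertIncl X Y k) = 0 := by
  simp [contactForm_apply, vertIncl_apply]

theorem contactForm_add (v k : X →L[ℝ] Y) :
    contactForm (v + k) = contactForm v - k.comp (baseProj X Y) := by
  rw [contactForm, contactForm, ContinuousLinearMap.add_comp, sub_sub]

variable [FiniteDimensional ℝ X]

variable (X Y) in
/-- The linear map `p^♯ : Y → X` that represents a linear form `p` on `Hom(X, Y)` through the trace
pairing, `p(k) = tr(p^♯ ∘ k)`; if `p = ∂L/∂v^A_α` then `p^♯ = ∂L/∂v^A_α dy^A ⊗ ∂/∂x^α`. It is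
written in a basis of `X` to make it a continuous linear function of `p`. -/
def traceRepr : ((X →L[ℝ] Y) →L[ℝ] ℝ) →L[ℝ] (Y →L[ℝ] X) :=
  ∑ a, ((ContinuousLinearMap.smulRightL ℝ Y X).flip (Module.finBasis ℝ X a)).comp
    ((ContinuousLinearMap.compL ℝ Y (X →L[ℝ] Y) ℝ).flip (ContinuousLinearMap.smulRightL ℝ X Y
      (LinearMap.toContinuousLinearMap ((Module.finBasis ℝ X).coord a))))

theorem traceRepr_apply (p : (X →L[ℝ] Y) →L[ℝ] ℝ) (u : Y) :
    traceRepr X Y p u = ∑ a, p ((LinearMap.toContinuousLinearMap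
      ((Module.finBasis ℝ X).coord a)).smulRight u) • Module.finBasis ℝ X a := by
  simp [traceRepr]

theorem apply_traceRepr (β : X →L[ℝ] ℝ) (p : (X →L[ℝ] Y) →L[ℝ] ℝ) (u : Y) :
    β (traceRepr X Y p u) = p (β.smulRight u) := by
  have hβ : β.smulRight u = ∑ a, β (Module.finBasis ℝ X a) • (LinearMap.toContinuousLinearMap
      ((Module.finBasis ℝ X).coord a)).smulRight u := by
    ext x
    conv_lhs => rw [← (Module.finBasis ℝ X).sum_repr x]
    simp [-Module.Basis.sum_repr, smul_smul, mul_comm]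
  rw [traceRepr_apply, hβ]
  simp [mul_comm]

theorem trace_traceRepr_comp (p : (X →L[ℝ] Y) →L[ℝ] ℝ) (k : X →L[ℝ] Y) :
    LinearMap.trace ℝ X ((traceRepr X Y p).comp k).toLinearMap = p k := by
  have hk : k = ∑ a, (LinearMap.toContinuousLinearMap
      ((Module.finBasis ℝ X).coord a)).smulRight (k (Module.finBasis ℝ X a)) := by
    ext x
    conv_lhs => rw [← (Module.finBasis ℝ X).sum_repr x]
    simp [-Module.Basis.sum_repr]
  rw [LinearMap.trace_eq_matrix_trace ℝ (Module.finBasis ℝ X), Matrix.trace]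
  conv_rhs => rw [hk, map_sum]
  refine Finset.sum_congr rfl fun a _ => ?_
  rw [Matrix.diag_apply, LinearMap.toMatrix_apply]
  exact apply_traceRepr (LinearMap.toContinuousLinearMap ((Module.finBasis ℝ X).coord a)) p _

theorem tensorContract_traceRepr {m : ℕ} (hX : Module.finrank ℝ X = m) (ν : X [⋀^Fin m]→L[ℝ] ℝ)
    (p : (X →L[ℝ] Y) →L[ℝ] ℝ) (k : X →L[ℝ] Y) {V : Type*} [AddCommGroup V] [Module ℝ V]
    [TopologicalSpace V] (T : V →L[ℝ] X) :
    tensorContract (((traceRepr X Y p).comp k).comp T) T ν = p k • ν.compContinuousLinearMap T := by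
  rw [tensorContract_comp_eq_trace_smul hX, trace_traceRepr_comp]

/-- The momenta `∂l/∂v^A_α (dy^A - v^A_ν dx^ν) ⊗ ∂/∂x^α` of a Lagrangian function `l`. -/
def momentum (l : X × Y × (X →L[ℝ] Y) → ℝ) (w : X × Y × (X →L[ℝ] Y)) :
    X × Y × (X →L[ℝ] Y) →L[ℝ] X :=
  (traceRepr X Y ((fderiv ℝ l w).comp (vertIncl X Y))).comp (contactForm w.2.2)

theorem apply_momentum (β : X →L[ℝ] ℝ) (l : X × Y × (X →L[ℝ] Y) → ℝ) (w Z : X × Y × (X →L[ℝ] Y)) :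
    β (momentum l w Z) = fderiv ℝ l w (vertIncl X Y (β.smulRight (contactForm w.2.2 Z))) :=
  apply_traceRepr β _ _

/-- The Poincaré–Cartan form of the Lagrangian density `l ν` in natural coordinates. -/
def coordTheta {m : ℕ} (ν : X → X [⋀^Fin m]→L[ℝ] ℝ) (l : X × Y × (X →L[ℝ] Y) → ℝ)
    (w : X × Y × (X →L[ℝ] Y)) : (X × Y × (X →L[ℝ] Y)) [⋀^Fin m]→L[ℝ] ℝ :=
  tensorContract (momentum l w) (baseProj X Y) (ν w.1) +
    l w • (ν w.1).compContinuousLinearMap (baseProj X Y)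

/-- The fibre Hessian `∂²l/∂v^A_α ∂v^B_ν`, evaluated on `k` and left as a linear form. -/
def velocityHessian (l : X × Y × (X →L[ℝ] Y) → ℝ) (w : X × Y × (X →L[ℝ] Y)) (k : X →L[ℝ] Y) :
    (X →L[ℝ] Y) →L[ℝ] ℝ :=
  (fderiv ℝ (fderiv ℝ l) w (vertIncl X Y k)).comp (vertIncl X Y)

variable {m : ℕ} {ν : X → X [⋀^Fin m]→L[ℝ] ℝ} {l : X × Y × (X →L[ℝ] Y) → ℝ}
  {w : X × Y × (X →L[ℝ] Y)}

theorem hasLineDerivAt_momentum (hl : ContDiffAt ℝ 2 l w) (k : X →L[ℝ] Y) :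
    HasLineDerivAt ℝ (momentum l)
      ((traceRepr X Y (velocityHessian l w k)).comp (contactForm w.2.2) -
        ((traceRepr X Y ((fderiv ℝ l w).comp (vertIncl X Y))).comp k).comp (baseProj X Y))
      w (vertIncl X Y k) := by
  have hdl : HasDerivAt (fun t : ℝ => fderiv ℝ l (w + t • vertIncl X Y k))
      (fderiv ℝ (fderiv ℝ l) w (vertIncl X Y k)) 0 :=
    ((differentiableAt_fderiv_of_contDiffAt_two hl).hasFDerivAt.hasLineDerivAt
      (vertIncl X Y k) :)
  have hp : HasDerivAt
      (fun t : ℝ => traceRepr X Y ((fderiv ℝ l (w + t • vertIncl X Y k)).comp (vertIncl X Y)))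
      (traceRepr X Y (velocityHessian l w k)) 0 :=
    ((hasDerivAt_const (0 : ℝ) (traceRepr X Y)).clm_apply
      (hdl.clm_comp (hasDerivAt_const (0 : ℝ) (vertIncl X Y)))).congr_deriv
        (by simp [velocityHessian])
  have hc : HasDerivAt (fun t : ℝ => contactForm (w + t • vertIncl X Y k).2.2)
      (-k.comp (baseProj X Y)) 0 := by
    have hlin : (fun t : ℝ => contactForm (w + t • vertIncl X Y k).2.2) =
        fun t : ℝ => contactForm w.2.2 - t • k.comp (baseProj X Y) :=
      funext fun t => contactForm_add w.2.2 (t • k)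
    rw [hlin]
    simpa using ((hasDerivAt_id (0 : ℝ)).smul_const (k.comp (baseProj X Y))).const_sub
      (contactForm w.2.2)
  refine (hp.clm_comp hc).congr_deriv ?_
  simp [sub_eq_add_neg, ContinuousLinearMap.comp_assoc]

theorem hasLineDerivAt_coordTheta (hX : Module.finrank ℝ X = m) (ν : X → X [⋀^Fin m]→L[ℝ] ℝ)
    (hl : ContDiffAt ℝ 2 l w) (k : X →L[ℝ] Y) :
    HasLineDerivAt ℝ (coordTheta ν l)
      (tensorContract ((traceRepr X Y (velocityHessian l w k)).comp (contactForm w.2.2))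
        (baseProj X Y) (ν w.1)) w (vertIncl X Y k) := by
  have hP : HasDerivAt _ _ (0 : ℝ) := hasLineDerivAt_momentum hl k
  have hl' : HasDerivAt _ _ (0 : ℝ) :=
    (hl.differentiableAt (by norm_num)).hasFDerivAt.hasLineDerivAt (vertIncl X Y k)
  have hline : (fun t : ℝ => coordTheta ν l (w + t • vertIncl X Y k)) = fun t =>
      (ν w.1).fderivCompContinuousLinearMap (baseProj X Y) (momentum l (w + t • vertIncl X Y k)) +
        l (w + t • vertIncl X Y k) • (ν w.1).compContinuousLinearMap (baseProj X Y) := by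
    funext t
    have hbase : (w + t • vertIncl X Y k).1 = w.1 := by simp [vertIncl_apply]
    rw [coordTheta, hbase, tensorContract_eq_fderivCompContinuousLinearMap]
  rw [HasLineDerivAt, hline]
  refine ((((ν w.1).fderivCompContinuousLinearMap (baseProj X Y)).hasFDerivAt.comp_hasDerivAt 0
    hP).add (hl'.smul_const _)).congr_deriv ?_
  -- The derivative of the contact forms in the momenta cancels the derivative of `l ν`.
  rw [map_sub, ← tensorContract_eq_fderivCompContinuousLinearMap,
    ← tensorContract_eq_fderivCompContinuousLinearMap, tensorContract_traceRepr hX]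
  exact sub_add_cancel _ _

theorem differentiableAt_momentum [FiniteDimensional ℝ Y] (hl : ContDiffAt ℝ 2 l w) :
    DifferentiableAt ℝ (momentum l) w := by
  have hdl := differentiableAt_fderiv_of_contDiffAt_two hl
  unfold momentum contactForm
  fun_prop

theorem differentiableAt_coordTheta [FiniteDimensional ℝ Y] (hν : DifferentiableAt ℝ ν w.1)
    (hl : ContDiffAt ℝ 2 l w) : DifferentiableAt ℝ (coordTheta ν l) w := by
  have hν' : DifferentiableAt ℝ (fun w : X × Y × (X →L[ℝ] Y) => ν w.1) w :=
    hν.comp w differentiableAt_fst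
  have hpullback : DifferentiableAt ℝ (fun w : X × Y × (X →L[ℝ] Y) =>
      (ν w.1).compContinuousLinearMap (baseProj X Y)) w :=
    hν'.continuousAlternatingMapCompContinuousLinearMap (differentiableAt_const _)
  have hmomentum := differentiableAt_tensorContract (differentiableAt_momentum hl) hν'
    (baseProj X Y)
  have hl' := hl.differentiableAt two_ne_zero
  exact hmomentum.fun_add (hl'.fun_smul (F := (X × Y × (X →L[ℝ] Y)) [⋀^Fin m]→L[ℝ] ℝ) hpullback)

theorem coordTheta_cons_vertIncl (ν : X → X [⋀^Fin (m + 1)]→L[ℝ] ℝ)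
    (l : X × Y × (X →L[ℝ] Y) → ℝ) (w : X × Y × (X →L[ℝ] Y)) (k : X →L[ℝ] Y)
    (Z : Fin m → X × Y × (X →L[ℝ] Y)) :
    coordTheta ν l w (Fin.cons (vertIncl X Y k) Z) = 0 := by
  have hbase : baseProj X Y (vertIncl X Y k) = 0 := rfl
  have hmomentum : momentum l w (vertIncl X Y k) = 0 := by simp [momentum, contactForm_vertIncl]
  have hzero (i : Fin (m + 1)) : ν w.1 (Function.update (baseProj X Y ∘ Fin.cons (vertIncl X Y k) Z)
      i (momentum l w (Fin.cons (α := fun _ => X × Y × (X →L[ℝ] Y)) (vertIncl X Y k) Z i))) =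
        0 := by
    refine (ν w.1).map_coord_zero 0 ?_
    rcases eq_or_ne 0 i with rfl | hi
    · simpa using hmomentum
    · simpa [hi] using hbase
  rw [coordTheta, ContinuousAlternatingMap.add_apply, tensorContract_apply,
    Finset.sum_eq_zero fun i _ => hzero i, zero_add, ContinuousAlternatingMap.smul_apply,
    ContinuousAlternatingMap.compContinuousLinearMap_apply, (ν w.1).map_coord_zero 0 hbase,
    smul_zero]

theorem extDeriv_coordTheta_cons [FiniteDimensional ℝ Y] (hX : Module.finrank ℝ X = m)
    (hν : DifferentiableAt ℝ ν w.1) (hl : ContDiffAt ℝ 2 l w) (k : X →L[ℝ] Y)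
    (Z : Fin m → X × Y × (X →L[ℝ] Y)) :
    extDeriv (coordTheta ν l) w (Fin.cons (vertIncl X Y k) Z) =
      tensorContract ((traceRepr X Y (velocityHessian l w k)).comp (contactForm w.2.2))
        (baseProj X Y) (ν w.1) Z := by
  have hΘ := differentiableAt_coordTheta hν hl
  have hvert : fderiv ℝ (coordTheta ν l) w (vertIncl X Y k) = _ :=
    hΘ.lineDeriv_eq_fderiv.symm.trans (hasLineDerivAt_coordTheta hX ν hl k).lineDeriv
  rw [extDeriv_apply hΘ, Fin.sum_univ_succ, Finset.sum_eq_zero, add_zero]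
  · rw [Fin.removeNth_zero, Fin.tail_cons,
      fderiv_continuousAlternatingMap_apply_const_apply hΘ, Fin.cons_zero, hvert]
    simp
  · intro i _
    cases m with
    | zero => exact i.elim0
    | succ m =>
      have hconst : (fun w => coordTheta ν l w (i.succ.removeNth
          (Fin.cons (vertIncl X Y k) Z : Fin (m + 2) → X × Y × (X →L[ℝ] Y)))) = fun _ => 0 := by
        funext w
        exact (congrArg _ (Fin.cons_comp_succ_succAbove _ _ _)).trans
          (coordTheta_cons_vertIncl ν l w k _)
      rw [hconst]
      simp

theorem extDeriv_coordTheta_cons_eq_smul [FiniteDimensional ℝ Y] (hX : Module.finrank ℝ X = m)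
    (hν : DifferentiableAt ℝ ν w.1) (hl : ContDiffAt ℝ 2 l w) (k G : X →L[ℝ] Y)
    {Z : Fin m → X × Y × (X →L[ℝ] Y)}
    (hG : ∀ i, G (baseProj X Y (Z i)) = contactForm w.2.2 (Z i)) :
    extDeriv (coordTheta ν l) w (Fin.cons (vertIncl X Y k) Z) =
      velocityHessian l w k G • ν w.1 (baseProj X Y ∘ Z) := by
  have hcontract := DFunLike.congr_fun
    (tensorContract_traceRepr hX (ν w.1) (velocityHessian l w k) G (baseProj X Y)) Z
  rw [extDeriv_coordTheta_cons hX hν hl]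
  refine Eq.trans ?_ hcontract
  simp only [tensorContract_apply, ContinuousLinearMap.comp_apply, hG]

theorem contactForm_eq_zero_of_extDeriv_eq_zero [FiniteDimensional ℝ Y]
    (hX : Module.finrank ℝ X = m) (hν : DifferentiableAt ℝ ν w.1) (hl : ContDiffAt ℝ 2 l w)
    (hreg : ∀ k, velocityHessian l w k = 0 → k = 0) {Z : Fin m → X × Y × (X →L[ℝ] Y)}
    (hZ : ν w.1 (baseProj X Y ∘ Z) ≠ 0)
    (hd : ∀ k, extDeriv (coordTheta ν l) w (Fin.cons (vertIncl X Y k) Z) = 0) (i : Fin m) :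
    contactForm w.2.2 (Z i) = 0 := by
  have hli : LinearIndependent ℝ (baseProj X Y ∘ Z) :=
    not_imp_comm.1 ((ν w.1).toAlternatingMap.map_linearDependent _) hZ
  let b := basisOfLinearIndependentOfCardEqFinrank' _ hli (by simp [hX])
  let G : X →L[ℝ] Y :=
    LinearMap.toContinuousLinearMap (b.constr ℝ fun i => contactForm w.2.2 (Z i))
  have hG (i) : G (baseProj X Y (Z i)) = contactForm w.2.2 (Z i) := by
    have hb : b i = baseProj X Y (Z i) := by simp [b]
    rw [← hb]
    exact b.constr_basis ℝ _ i
  have hHessian (k) : velocityHessian l w k G = 0 :=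
    (smul_eq_zero.1 ((extDeriv_coordTheta_cons_eq_smul hX hν hl k G hG).symm.trans
      (hd k))).resolve_right hZ
  have hG0 : G = 0 := hreg G <| ContinuousLinearMap.ext fun k =>
    ((hl.isSymmSndFDerivAt (by simp)).eq _ _).trans (hHessian k)
  rw [← hG, hG0, zero_apply]

theorem extDeriv_coordTheta_cons_eq_zero [FiniteDimensional ℝ Y] (hX : Module.finrank ℝ X = m)
    (hν : DifferentiableAt ℝ ν w.1) (hl : ContDiffAt ℝ 2 l w) {k : X →L[ℝ] Y}
    (hk : velocityHessian l w k = 0) (Z : Fin m → X × Y × (X →L[ℝ] Y)) :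
    extDeriv (coordTheta ν l) w (Fin.cons (vertIncl X Y k) Z) = 0 := by
  rw [extDeriv_coordTheta_cons hX hν hl, hk, map_zero, ContinuousLinearMap.zero_comp,
    tensorContract_eq_fderivCompContinuousLinearMap, map_zero]
  rfl

end NaturalCoordinates

section Manifold

variable {V : Type*} [NormedAddCommGroup V] [NormedSpace ℝ V]
  {N : Type*} [TopologicalSpace N] [ChartedSpace V N] [IsManifold 𝓘(ℝ, V) ∞ N]
  {k : ℕ} {α : (q : N) → TangentSpace 𝓘(ℝ, V) q [⋀^Fin k]→L[ℝ] ℝ} {p q : N}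

theorem IsLocallyDecomposable.exists_eq_ιMulti
    {X : (q : N) → ⋀[ℝ]^k (TangentSpace 𝓘(ℝ, V) q)} (hX : IsLocallyDecomposable X) (q : N) :
    ∃ Y : Fin k → TangentSpace 𝓘(ℝ, V) q, X q = exteriorPower.ιMulti ℝ k Y := by
  obtain ⟨_, -, hqU, _, -, hY⟩ := hX q
  exact ⟨_, hY q hqU⟩

theorem chartForm_comp_mfderiv (hq : q ∈ (chartAt V p).source) :
    (chartForm α p (chartAt V p q)).compContinuousLinearMap
      (mfderiv 𝓘(ℝ, V) 𝓘(ℝ, V) (chartAt V p) q) = α q := by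
  have hα : (α ((chartAt V p).symm (chartAt V p q)) : V [⋀^Fin k]→L[ℝ] ℝ) = α q :=
    congrArg (show N → V [⋀^Fin k]→L[ℝ] ℝ from α) ((chartAt V p).left_inv hq)
  ext Z
  refine (DFunLike.congr_fun hα _).trans (congrArg (α q) (funext fun i => ?_))
  exact DFunLike.congr_fun
    ((mdifferentiable_chart (I := 𝓘(ℝ, V)) p).symm_comp_deriv hq) (Z i)

theorem chartForm_eq_of_forall_eq_comp_mfderiv {β : V → V [⋀^Fin k]→L[ℝ] ℝ}
    (h : ∀ q ∈ (chartAt V p).source, α q = (β (chartAt V p q)).compContinuousLinearMap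
      (mfderiv 𝓘(ℝ, V) 𝓘(ℝ, V) (chartAt V p) q))
    {z : V} (hz : z ∈ (chartAt V p).target) : chartForm α p z = β z := by
  rw [chartForm, h _ ((chartAt V p).map_target hz), (chartAt V p).right_inv hz]
  ext Z
  exact congrArg (β z) (funext fun i => DFunLike.congr_fun
    ((mdifferentiable_chart (I := 𝓘(ℝ, V)) p).comp_symm_deriv hz) (Z i))

theorem manifoldExtDeriv_eq_of_forall_eq_comp_mfderiv {β : V → V [⋀^Fin k]→L[ℝ] ℝ}
    (h : ∀ q ∈ (chartAt V p).source, α q = (β (chartAt V p q)).compContinuousLinearMap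
      (mfderiv 𝓘(ℝ, V) 𝓘(ℝ, V) (chartAt V p) q)) :
    manifoldExtDeriv α p = (extDeriv β (chartAt V p p)).compContinuousLinearMap
      (mfderiv 𝓘(ℝ, V) 𝓘(ℝ, V) (chartAt V p) p) := by
  have hβ : chartForm α p =ᶠ[𝓝 (chartAt V p p)] β := by
    filter_upwards [(chartAt V p).open_target.mem_nhds (mem_chart_target V p)] with z hz
    exact chartForm_eq_of_forall_eq_comp_mfderiv h hz
  rw [manifoldExtDeriv, hβ.extDeriv_eq]

variable {W : Type*} [NormedAddCommGroup W] [NormedSpace ℝ W] {g : W → N} {u : W}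

theorem pullback_eq_chartForm_comp_fderiv (hg : MDifferentiableAt 𝓘(ℝ, W) 𝓘(ℝ, V) g u)
    (hp : g u ∈ (chartAt V p).source) :
    (α (g u)).compContinuousLinearMap (mfderiv 𝓘(ℝ, W) 𝓘(ℝ, V) g u) =
      (chartForm α p (chartAt V p (g u))).compContinuousLinearMap
        (fderiv ℝ (chartAt V p ∘ g) u) := by
  have hchain : fderiv ℝ (chartAt V p ∘ g) u =
      (mfderiv 𝓘(ℝ, V) 𝓘(ℝ, V) (chartAt V p) (g u)).comp (mfderiv 𝓘(ℝ, W) 𝓘(ℝ, V) g u) := by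
    rw [← mfderiv_eq_fderiv]
    exact mfderiv_comp u ((mdifferentiable_chart p).mdifferentiableAt hp) hg
  ext Z
  rw [ContinuousAlternatingMap.compContinuousLinearMap_apply, hchain]
  exact (DFunLike.congr_fun (chartForm_comp_mfderiv hp) _).symm

theorem IsSmoothForm.differentiableAt_pullback (hα : IsSmoothForm α)
    (hg : ContMDiffAt 𝓘(ℝ, W) 𝓘(ℝ, V) 2 g u) :
    DifferentiableAt ℝ (fun z => ((α (g z)).compContinuousLinearMap
      (mfderiv 𝓘(ℝ, W) 𝓘(ℝ, V) g z) : W [⋀^Fin k]→L[ℝ] ℝ)) u := by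
  have hchart : chartAt V (g u) (g u) ∈ (chartAt V (g u)).target := mem_chart_target V (g u)
  have hφg : ContDiffAt ℝ 2 (chartAt V (g u) ∘ g) u :=
    ((contMDiffAt_of_mem_maximalAtlas (IsManifold.chart_mem_maximalAtlas (g u))
      (mem_chart_source V (g u))).comp u hg).contDiffAt
  have hαφ : DifferentiableAt ℝ (chartForm α (g u)) (chartAt V (g u) (g u)) :=
    ((hα (g u)).contDiffAt ((chartAt V (g u)).open_target.mem_nhds hchart)).differentiableAt
      (by simp)
  refine ((hαφ.comp u (hφg.differentiableAt two_ne_zero)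
    ).continuousAlternatingMapCompContinuousLinearMap
      (differentiableAt_fderiv_of_contDiffAt_two hφg)).congr_of_eventuallyEq ?_
  filter_upwards [(contMDiffAt_iff_contMDiffAt_nhds (by simp)).1 hg,
    hg.continuousAt.preimage_mem_nhds ((chartAt V (g u)).open_source.mem_nhds
      (mem_chart_source V (g u)))] with z hgz hz
  exact pullback_eq_chartForm_comp_fderiv (hgz.mdifferentiableAt two_ne_zero) hz

end Manifold

namespace SmoothFibreBundle

variable {m n : ℕ} {M F E : Type*}
  [TopologicalSpace M] [ChartedSpace (Eu m) M] [TopologicalSpace F] [ChartedSpace (Eu n) F]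
  [TopologicalSpace E] [ChartedSpace (Eu (m + n)) E]
  {B : SmoothFibreBundle m n M F E}

namespace FibredChart

variable (c : B.FibredChart)

/-- The coordinate expression on the base of an `m`-form `η` in a fibred chart. -/
def volCoord (η : (x : M) → TangentSpace (𝓡 m) x [⋀^Fin m]→L[ℝ] ℝ)
    (u : Eu m) : Eu m [⋀^Fin m]→L[ℝ] ℝ :=
  (η (c.base.symm u)).compContinuousLinearMap (c.dbaseSymm u)

/-- The natural coordinates `k^A_α` of an element of `T_x^*M ⊗ V_y(π)`. -/
def vertCoord (j : B.J1) : j.VHom →L[ℝ] Eu m →L[ℝ] Eu n :=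
  (((ContinuousLinearMap.compL ℝ (Eu m) (Eu m) (Eu n)).flip
      (c.dbaseSymm (c.total j.pt).1)).comp
    (ContinuousLinearMap.compL ℝ (Eu m) (Eu (m + n)) (Eu n)
      ((ContinuousLinearMap.snd ℝ (Eu m) (Eu n)).comp (c.dtotal j.pt)))).comp j.VHom.subtypeL

theorem vertCoord_apply (j : B.J1) (k : j.VHom) (a : Eu m) :
    c.vertCoord j k a =
      (c.dtotal j.pt ((k : Eu m →L[ℝ] Eu (m + n)) (c.dbaseSymm (c.total j.pt).1 a))).2 := rfl

variable {c} {y : E}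

theorem total_fst_mem (hy : y ∈ c.total.source) : (c.total y).1 ∈ c.base.target :=
  c.base_proj y hy ▸ c.base.map_source (c.proj_mem y hy)

theorem base_symm_total_fst (hy : y ∈ c.total.source) :
    c.base.symm (c.total y).1 = B.proj y := by
  rw [← c.base_proj y hy, c.base.left_inv (c.proj_mem y hy)]

theorem volCoord_comp_apply (hy : y ∈ c.total.source)
    (η : (x : M) → TangentSpace (𝓡 m) x [⋀^Fin m]→L[ℝ] ℝ) (a : Fin m → Eu m) :
    c.volCoord η (c.total y).1 a = η (B.proj y) (c.dbaseSymm (c.total y).1 ∘ a) :=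
  DFunLike.congr_fun (congrArg (show M → Eu m [⋀^Fin m]→L[ℝ] ℝ from η) (base_symm_total_fst hy)) _

theorem differentiableAt_volCoord [IsManifold (𝓡 m) ∞ M]
    {η : (x : M) → TangentSpace (𝓡 m) x [⋀^Fin m]→L[ℝ] ℝ}
    (hη : IsSmoothForm η) {u : Eu m} (hu : u ∈ c.base.target) :
    DifferentiableAt ℝ (c.volCoord η) u :=
  hη.differentiableAt_pullback (((c.base_symm_smooth u hu).contMDiffAt
    (c.base.open_target.mem_nhds hu)).of_le (WithTop.coe_le_coe.2 le_top))

variable [IsManifold (𝓡 m) ∞ M] [IsManifold (𝓡 n) ∞ F] [IsManifold (𝓡 (m + n)) ∞ E]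

theorem dtotal_dtotalSymm_apply (hy : y ∈ c.total.source) (v : Eu m × Eu n) :
    c.dtotal y (c.dtotalSymm (c.total y) v) = v := by
  have h := c.dtotal_dtotalSymm (c.total.map_source hy)
  rw [c.total.left_inv hy] at h
  exact DFunLike.congr_fun h v

theorem dbase_dbaseSymm_apply (hy : y ∈ c.total.source) (a : Eu m) :
    c.dbase (B.proj y) (c.dbaseSymm (c.total y).1 a) = a := by
  have h := c.dbase_dbaseSymm (total_fst_mem hy)
  rw [base_symm_total_fst hy] at h
  exact DFunLike.congr_fun h a

theorem dproj_dtotalSymm (hy : y ∈ c.total.source) (v : Eu m × Eu n) :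
    B.dproj y (c.dtotalSymm (c.total y) v) = c.dbaseSymm (c.total y).1 v.1 := by
  have hbase := DFunLike.congr_fun (c.dbaseSymm_dbase (c.proj_mem y hy))
    (B.dproj y (c.dtotalSymm (c.total y) v))
  have hproj : c.dbase (B.proj y) (B.dproj y (c.dtotalSymm (c.total y) v)) = v.1 :=
    (DFunLike.congr_fun (c.dbase_dproj hy) _).trans
      (congrArg Prod.fst (dtotal_dtotalSymm_apply hy v))
  rw [ContinuousLinearMap.comp_apply, hproj, c.base_proj y hy] at hbase
  exact hbase.symm

theorem lin_dbaseSymm {j : B.J1} (hj : j.pt ∈ c.total.source) (a : Eu m) :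
    j.lin (c.dbaseSymm (c.total j.pt).1 a) =
      c.dtotalSymm (c.total j.pt) (a, c.velocity j a) := by
  rw [← c.linOf_velocity hj, linOf, ContinuousLinearMap.comp_apply, c.total.left_inv hj,
    dbase_dbaseSymm_apply hj]
  rfl

theorem vertCoord_surjective {j : B.J1} (hj : j.pt ∈ c.total.source) :
    Function.Surjective (c.vertCoord j) := by
  intro κ
  have hvert : (B.dproj j.pt).comp (((c.dtotalSymm (c.total j.pt)).comp
      ((ContinuousLinearMap.inr ℝ (Eu m) (Eu n)).comp κ)).comp (c.dbase (B.proj j.pt))) = 0 := by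
    ext1 a
    exact (dproj_dtotalSymm hj _).trans (map_zero _)
  refine ⟨⟨_, hvert⟩, ContinuousLinearMap.ext fun a => ?_⟩
  simp only [vertCoord_apply, ContinuousLinearMap.comp_apply, dtotal_dtotalSymm_apply hj,
    dbase_dbaseSymm_apply hj, ContinuousLinearMap.inr_apply]

end FibredChart

namespace J1

variable [IsManifold (𝓡 m) ∞ M] [IsManifold (𝓡 n) ∞ F] [IsManifold (𝓡 (m + n)) ∞ E]

/-- The fibred chart that induces the preferred natural coordinates of `J¹π` around `j₀`. -/
def fibredChart (j₀ : B.J1) : B.FibredChart := (B.exists_fibredChart j₀.pt).choose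

/-- The tangent map at `j` of the natural coordinates `(x^α, y^A, v^A_α)` around `j₀`. -/
def dchart (j₀ j : B.J1) : TangentSpace 𝓘(ℝ, J1Model m n) j →L[ℝ] J1Model m n :=
  mfderiv 𝓘(ℝ, J1Model m n) 𝓘(ℝ, J1Model m n) (chartAt (J1Model m n) j₀) j

/-- The expression of a function on `J¹π` in the natural coordinates around `j₀`. -/
def coordFun (j₀ : B.J1) (L : B.J1 → ℝ) : J1Model m n → ℝ :=
  L ∘ (chartAt (J1Model m n) j₀).symm

theorem chartAt_apply (j₀ j : B.J1) : chartAt (J1Model m n) j₀ j =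
    ((j₀.fibredChart.total j.pt).1, (j₀.fibredChart.total j.pt).2, j₀.fibredChart.velocity j) := rfl

variable {j₀ j : B.J1}

theorem mem_chartAt_source :
    j ∈ (chartAt (J1Model m n) j₀).source ↔ j.pt ∈ j₀.fibredChart.total.source := Iff.rfl

theorem hasMFDerivAt_chartAt (hj : j ∈ (chartAt (J1Model m n) j₀).source) :
    HasMFDerivAt 𝓘(ℝ, J1Model m n) 𝓘(ℝ, J1Model m n) (chartAt (J1Model m n) j₀) j (dchart j₀ j) :=
  ((mdifferentiable_chart j₀).mdifferentiableAt hj).hasMFDerivAt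

theorem dchart_bijective (hj : j ∈ (chartAt (J1Model m n) j₀).source) :
    Function.Bijective (dchart j₀ j) :=
  (mdifferentiable_chart j₀).mfderiv_bijective hj

theorem dpt_apply_eq_dtotalSymm (hj : j ∈ (chartAt (J1Model m n) j₀).source)
    (Z : TangentSpace 𝓘(ℝ, J1Model m n) j) :
    j.dpt Z = j₀.fibredChart.dtotalSymm (j₀.fibredChart.total j.pt)
      ((dchart j₀ j Z).1, (dchart j₀ j Z).2.1) := by
  let q : J1Model m n →L[ℝ] Eu m × Eu n :=
    (ContinuousLinearMap.fst ℝ _ _).prod ((ContinuousLinearMap.fst ℝ _ _).comp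
      (ContinuousLinearMap.snd ℝ (Eu m) (Eu n × (Eu m →L[ℝ] Eu n))))
  have hq : HasMFDerivAt 𝓘(ℝ, J1Model m n) 𝓘(ℝ, Eu m × Eu n) (q ∘ chartAt (J1Model m n) j₀) j
      (q.comp (dchart j₀ j)) :=
    HasMFDerivAt.comp j q.hasFDerivAt.hasMFDerivAt (hasMFDerivAt_chartAt hj)
  have hsymm : HasMFDerivAt 𝓘(ℝ, Eu m × Eu n) (𝓡 (m + n)) j₀.fibredChart.total.symm
      ((q ∘ chartAt (J1Model m n) j₀) j) (j₀.fibredChart.dtotalSymm (j₀.fibredChart.total j.pt)) :=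
    (j₀.fibredChart.total_mdiff.mdifferentiableAt_symm
      (j₀.fibredChart.total.map_source hj)).hasMFDerivAt
  have hpt : (J1.pt : B.J1 → E) =ᶠ[𝓝 j]
      j₀.fibredChart.total.symm ∘ q ∘ chartAt (J1Model m n) j₀ := by
    filter_upwards [(chartAt (J1Model m n) j₀).open_source.mem_nhds hj] with i hi
    exact (j₀.fibredChart.total.left_inv hi).symm
  exact DFunLike.congr_fun ((HasMFDerivAt.comp j hsymm hq).congr_of_eventuallyEq hpt).mfderiv Z

theorem dbar_apply_eq_dbaseSymm (hj : j ∈ (chartAt (J1Model m n) j₀).source)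
    (Z : TangentSpace 𝓘(ℝ, J1Model m n) j) :
    j.dbar Z = j₀.fibredChart.dbaseSymm (j₀.fibredChart.total j.pt).1
      (baseProj _ _ (dchart j₀ j Z)) := by
  rw [dbar, ContinuousLinearMap.comp_apply, dpt_apply_eq_dtotalSymm hj,
    FibredChart.dproj_dtotalSymm (mem_chartAt_source.1 hj)]
  rfl

theorem structureForm_apply_eq_dtotalSymm (hj : j ∈ (chartAt (J1Model m n) j₀).source)
    (Z : TangentSpace 𝓘(ℝ, J1Model m n) j) :
    j.structureForm Z = j₀.fibredChart.dtotalSymm (j₀.fibredChart.total j.pt)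
      (0, contactForm (j₀.fibredChart.velocity j) (dchart j₀ j Z)) := by
  change j.dpt Z - j.lin (j.dbar Z) = _
  rw [dpt_apply_eq_dtotalSymm hj, dbar_apply_eq_dbaseSymm hj,
    FibredChart.lin_dbaseSymm (mem_chartAt_source.1 hj), ← map_sub, Prod.mk_sub_mk,
    baseProj_apply, sub_self, contactForm_apply]

theorem chartAt_addVert (j₀ j : B.J1) (k : j.VHom) : chartAt (J1Model m n) j₀ (j.addVert k) =
    chartAt (J1Model m n) j₀ j + vertIncl _ _ (j₀.fibredChart.vertCoord j k) := by
  rw [chartAt_apply, chartAt_apply, vertIncl_apply]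
  exact Prod.ext (add_zero _).symm (Prod.ext (add_zero _).symm (ContinuousLinearMap.ext
    fun a => congrArg Prod.snd (map_add (j₀.fibredChart.dtotal j.pt) _ _)))

theorem addVert_eq_chartAt_symm (hj : j ∈ (chartAt (J1Model m n) j₀).source) (k : j.VHom) :
    j.addVert k = (chartAt (J1Model m n) j₀).symm
      (chartAt (J1Model m n) j₀ j + vertIncl _ _ (j₀.fibredChart.vertCoord j k)) := by
  rw [← chartAt_addVert]
  exact ((chartAt (J1Model m n) j₀).left_inv (x := j.addVert k) hj).symm

theorem mdifferentiableAt_addVert (j : B.J1) :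
    MDifferentiableAt 𝓘(ℝ, j.VHom) 𝓘(ℝ, J1Model m n) j.addVert 0 := by
  have hcoord : MDifferentiableAt 𝓘(ℝ, j.VHom) 𝓘(ℝ, J1Model m n) (fun k : j.VHom =>
      chartAt (J1Model m n) j j + vertIncl _ _ (j.fibredChart.vertCoord j k)) 0 :=
    DifferentiableAt.mdifferentiableAt (by fun_prop)
  have hsymm : MDifferentiableAt 𝓘(ℝ, J1Model m n) 𝓘(ℝ, J1Model m n) (chartAt (J1Model m n) j).symm
      (chartAt (J1Model m n) j j + vertIncl _ _ (j.fibredChart.vertCoord j 0)) := by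
    rw [map_zero, map_zero, add_zero]
    exact (mdifferentiable_chart j).mdifferentiableAt_symm (mem_chart_target _ j)
  rw [funext (addVert_eq_chartAt_symm (mem_chart_source (J1Model m n) j))]
  exact MDifferentiableAt.comp (0 : j.VHom) hsymm hcoord

theorem dchart_vertLift (hj : j ∈ (chartAt (J1Model m n) j₀).source) (k : j.VHom) :
    dchart j₀ j (j.vertLift k) = vertIncl _ _ (j₀.fibredChart.vertCoord j k) := by
  have hchart : HasMFDerivAt 𝓘(ℝ, J1Model m n) 𝓘(ℝ, J1Model m n) (chartAt (J1Model m n) j₀)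
      (j.addVert 0) (show J1Model m n →L[ℝ] J1Model m n from dchart j₀ j) := by
    rw [addVert_zero]
    exact hasMFDerivAt_chartAt hj
  have hcoord : HasMFDerivAt 𝓘(ℝ, j.VHom) 𝓘(ℝ, J1Model m n)
      (chartAt (J1Model m n) j₀ ∘ j.addVert) 0
      ((vertIncl (Eu m) (Eu n)).comp (j₀.fibredChart.vertCoord j)) := by
    rw [show chartAt (J1Model m n) j₀ ∘ j.addVert = _ from funext (chartAt_addVert j₀ j)]
    exact ((((vertIncl (Eu m) (Eu n)).comp (j₀.fibredChart.vertCoord j)).hasFDerivAt).const_add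
      _).hasMFDerivAt
  exact DFunLike.congr_fun (hasMFDerivAt_unique
    (HasMFDerivAt.comp (0 : j.VHom) hchart (mdifferentiableAt_addVert j).hasMFDerivAt) hcoord) k

theorem vertCoord_tensorVert (hj : j ∈ (chartAt (J1Model m n) j₀).source)
    (Z : TangentSpace 𝓘(ℝ, J1Model m n) j) (β : Module.Dual ℝ (Eu m)) :
    j₀.fibredChart.vertCoord j (j.tensorVert Z β) =
      ((LinearMap.toContinuousLinearMap β).comp
        (j₀.fibredChart.dbaseSymm (j₀.fibredChart.total j.pt).1)).smulRight
          (contactForm (j₀.fibredChart.velocity j) (dchart j₀ j Z)) := by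
  ext1 a
  rw [FibredChart.vertCoord_apply]
  change (j₀.fibredChart.dtotal j.pt (β _ • j.structureForm Z)).2 = β _ • _
  rw [map_smul, structureForm_apply_eq_dtotalSymm hj,
    FibredChart.dtotal_dtotalSymm_apply (mem_chartAt_source.1 hj)]
  rfl

section Lagrangian

variable {L : B.J1 → ℝ}

theorem contDiffAt_coordFun (hL : ContMDiff 𝓘(ℝ, J1Model m n) 𝓘(ℝ, ℝ) 2 L)
    (hj : j ∈ (chartAt (J1Model m n) j₀).source) :
    ContDiffAt ℝ 2 (coordFun j₀ L) (chartAt (J1Model m n) j₀ j) :=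
  (((hL.comp_contMDiffOn (contMDiffOn_chart_symm (I := 𝓘(ℝ, J1Model m n)) (x := j₀)))
    ).contMDiffAt ((chartAt (J1Model m n) j₀).open_target.mem_nhds
      ((chartAt (J1Model m n) j₀).map_source hj))).contDiffAt

theorem dL_apply_eq_fderiv_coordFun (hL : ContMDiff 𝓘(ℝ, J1Model m n) 𝓘(ℝ, ℝ) 2 L)
    (hj : j ∈ (chartAt (J1Model m n) j₀).source) (Z : TangentSpace 𝓘(ℝ, J1Model m n) j) :
    j.dL L Z = fderiv ℝ (coordFun j₀ L) (chartAt (J1Model m n) j₀ j) (dchart j₀ j Z) := by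
  have hcoord : HasMFDerivAt 𝓘(ℝ, J1Model m n) 𝓘(ℝ, ℝ) (coordFun j₀ L)
      (chartAt (J1Model m n) j₀ j) (fderiv ℝ (coordFun j₀ L) (chartAt (J1Model m n) j₀ j)) :=
    ((contDiffAt_coordFun hL hj).differentiableAt two_ne_zero).hasFDerivAt.hasMFDerivAt
  have hcomp : L =ᶠ[𝓝 j] coordFun j₀ L ∘ chartAt (J1Model m n) j₀ := by
    filter_upwards [(chartAt (J1Model m n) j₀).open_source.mem_nhds hj] with i hi
    exact congrArg L ((chartAt (J1Model m n) j₀).left_inv hi).symm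
  exact DFunLike.congr_fun ((HasMFDerivAt.comp j hcoord
    (hasMFDerivAt_chartAt hj)).congr_of_eventuallyEq hcomp).mfderiv Z

theorem vertEndoContract_apply_eq_momentum (hL : ContMDiff 𝓘(ℝ, J1Model m n) 𝓘(ℝ, ℝ) 2 L)
    (hj : j ∈ (chartAt (J1Model m n) j₀).source) (Z : TangentSpace 𝓘(ℝ, J1Model m n) j) :
    j.vertEndoContract L Z = j₀.fibredChart.dbaseSymm (j₀.fibredChart.total j.pt).1
      (momentum (coordFun j₀ L) (chartAt (J1Model m n) j₀ j) (dchart j₀ j Z)) := by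
  refine sub_eq_zero.1 ((Module.forall_dual_apply_eq_zero_iff ℝ _).1 fun β => ?_)
  have hβ : β (j.vertEndoContract L Z) = j.dL L (j.vertLift (j.tensorVert Z β)) :=
    Module.apply_evalEquiv_symm_apply ℝ (Eu m) β _
  rw [map_sub, sub_eq_zero, hβ, dL_apply_eq_fderiv_coordFun hL hj, dchart_vertLift hj,
    vertCoord_tensorVert hj]
  exact (apply_momentum ((LinearMap.toContinuousLinearMap β).comp
    (j₀.fibredChart.dbaseSymm (j₀.fibredChart.total j.pt).1)) (coordFun j₀ L) _ _).symm

variable {η : (x : M) → TangentSpace (𝓡 m) x [⋀^Fin m]→L[ℝ] ℝ}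

theorem volPullback_apply_eq_volCoord (hj : j ∈ (chartAt (J1Model m n) j₀).source)
    (Z : Fin m → TangentSpace 𝓘(ℝ, J1Model m n) j) :
    volPullback η j Z = j₀.fibredChart.volCoord η (j₀.fibredChart.total j.pt).1
      (baseProj _ _ ∘ dchart j₀ j ∘ Z) := by
  rw [FibredChart.volCoord_comp_apply (mem_chartAt_source.1 hj)]
  exact congrArg (η (B.proj j.pt)) (funext fun i => dbar_apply_eq_dbaseSymm hj (Z i))

theorem thetaL_eq_coordTheta_comp_dchart (hL : ContMDiff 𝓘(ℝ, J1Model m n) 𝓘(ℝ, ℝ) 2 L)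
    (hj : j ∈ (chartAt (J1Model m n) j₀).source) :
    thetaL η L j = (coordTheta (j₀.fibredChart.volCoord η) (coordFun j₀ L)
      (chartAt (J1Model m n) j₀ j)).compContinuousLinearMap (dchart j₀ j) := by
  have hLj : coordFun j₀ L (chartAt (J1Model m n) j₀ j) = L j :=
    congrArg L ((chartAt (J1Model m n) j₀).left_inv hj)
  ext Z
  have hterm (i : Fin m) : η (B.proj j.pt) (Function.update (j.dbar ∘ Z) i
      (j.vertEndoContract L (Z i))) =
      j₀.fibredChart.volCoord η (j₀.fibredChart.total j.pt).1 (Function.update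
        (baseProj _ _ ∘ dchart j₀ j ∘ Z) i
        (momentum (coordFun j₀ L) (chartAt (J1Model m n) j₀ j) (dchart j₀ j (Z i)))) := by
    rw [FibredChart.volCoord_comp_apply (mem_chartAt_source.1 hj),
      vertEndoContract_apply_eq_momentum hL hj]
    refine congrArg (η (B.proj j.pt)) (Eq.trans ?_ (Function.comp_update _ _ i _).symm)
    exact congrArg (fun f : Fin m → Eu m => Function.update f i _)
      (funext fun i => dbar_apply_eq_dbaseSymm hj (Z i))
  change ∑ i, η (B.proj j.pt) (Function.update (j.dbar ∘ Z) i (j.vertEndoContract L (Z i))) +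
    L j * volPullback η j Z = _
  rw [Finset.sum_congr rfl fun i _ => hterm i, volPullback_apply_eq_volCoord hj, ← hLj]
  rfl

theorem omegaL_cons_eq_neg_extDeriv (hL : ContMDiff 𝓘(ℝ, J1Model m n) 𝓘(ℝ, ℝ) 2 L) (j : B.J1)
    (W : TangentSpace 𝓘(ℝ, J1Model m n) j) (Z : Fin m → TangentSpace 𝓘(ℝ, J1Model m n) j) :
    omegaL η L j (Fin.cons W Z) = -extDeriv (coordTheta (j.fibredChart.volCoord η) (coordFun j L))
      (chartAt (J1Model m n) j j) (Fin.cons (dchart j j W) (dchart j j ∘ Z)) := by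
  have hΘ := manifoldExtDeriv_eq_of_forall_eq_comp_mfderiv (p := j)
    fun i hi => thetaL_eq_coordTheta_comp_dchart (η := η) (j₀ := j) hL hi
  refine congrArg Neg.neg ((DFunLike.congr_fun hΘ _).trans (congrArg (extDeriv
    (coordTheta (j.fibredChart.volCoord η) (coordFun j L)) (chartAt (J1Model m n) j j))
      (funext fun i => ?_)))
  cases i using Fin.cases <;> rfl

theorem fibreHessian_eq_velocityHessian (hL : ContMDiff 𝓘(ℝ, J1Model m n) 𝓘(ℝ, ℝ) 2 L) (j : B.J1)
    (k₁ k₂ : j.VHom) : fibreHessian L j k₁ k₂ =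
      velocityHessian (coordFun j L) (chartAt (J1Model m n) j j) (j.fibredChart.vertCoord j k₁)
        (j.fibredChart.vertCoord j k₂) := by
  refine Eq.trans ?_ (deriv_deriv_eq_fderiv_fderiv
    (contDiffAt_coordFun hL (mem_chart_source (J1Model m n) j)) _ _)
  refine congrArg (fun g : ℝ → ℝ => deriv g 0) (funext fun s => ?_)
  refine congrArg (fun g : ℝ → ℝ => deriv g 0) (funext fun t => ?_)
  rw [addVert_eq_chartAt_symm (mem_chart_source (J1Model m n) j)]
  simp only [map_add, map_smul]
  rfl

theorem eq_zero_of_velocityHessian_eq_zero (hη : IsSmoothForm η)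
    (hL : ContMDiff 𝓘(ℝ, J1Model m n) 𝓘(ℝ, ℝ) 2 L) (hreg : IsRegularLagrangian η L) (j : B.J1)
    {κ : Eu m →L[ℝ] Eu n}
    (hκ : velocityHessian (coordFun j L) (chartAt (J1Model m n) j j) κ = 0) : κ = 0 := by
  have hj := mem_chart_source (J1Model m n) j
  rcases hreg with hnondeg | hHess
  · obtain ⟨W, hW⟩ := (dchart_bijective hj).2 (vertIncl _ _ κ)
    have hW0 : W = 0 := hnondeg j W fun Z => by
      rw [omegaL_cons_eq_neg_extDeriv hL, hW, extDeriv_coordTheta_cons_eq_zero (by simp)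
        (FibredChart.differentiableAt_volCoord hη (FibredChart.total_fst_mem
          (mem_chartAt_source.1 hj))) (contDiffAt_coordFun hL hj) hκ, neg_zero]
    rw [hW0, map_zero] at hW
    exact (congrArg (fun w : J1Model m n => w.2.2) hW).symm
  · obtain ⟨k, rfl⟩ := FibredChart.vertCoord_surjective (mem_chartAt_source.1 hj) κ
    rw [hHess j k fun k₂ => by rw [fibreHessian_eq_velocityHessian hL, hκ]; rfl, map_zero]

end Lagrangian

theorem vertEndo_eq_zero_of_structureForm_eq_zero {Z : TangentSpace 𝓘(ℝ, J1Model m n) j}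
    (hZ : j.structureForm Z = 0) (β : Module.Dual ℝ (Eu m)) : j.vertEndo Z β = 0 := by
  have htensor : j.tensorVert Z β = 0 :=
    Subtype.ext <| ContinuousLinearMap.ext fun a => by
      change β a • j.structureForm Z = 0
      rw [hZ, smul_zero]
  exact (congrArg j.vertLift htensor).trans (map_zero _)

theorem structureForm_eq_zero_of_isRegularLagrangian
    {η : (x : M) → TangentSpace (𝓡 m) x [⋀^Fin m]→L[ℝ] ℝ} {L : B.J1 → ℝ}
    (hη : IsSmoothForm η) (hL : ContMDiff 𝓘(ℝ, J1Model m n) 𝓘(ℝ, ℝ) 2 L)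
    (hreg : IsRegularLagrangian η L) {Y : Fin m → TangentSpace 𝓘(ℝ, J1Model m n) j}
    (hω : volPullback η j Y ≠ 0) (hΩ : ∀ W, omegaL η L j (Fin.cons W Y) = 0) (i : Fin m) :
    j.structureForm (Y i) = 0 := by
  have hj := mem_chart_source (J1Model m n) j
  have hZ : j.fibredChart.volCoord η (chartAt (J1Model m n) j j).1
      (baseProj (Eu m) (Eu n) ∘ dchart j j ∘ Y) ≠ 0 :=
    fun h => hω ((volPullback_apply_eq_volCoord hj Y).trans h)
  have hd (κ) : extDeriv (coordTheta (j.fibredChart.volCoord η) (coordFun j L))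
      (chartAt (J1Model m n) j j) (Fin.cons (vertIncl _ _ κ) (dchart j j ∘ Y)) = 0 := by
    obtain ⟨W, hW⟩ := (dchart_bijective hj).2 (vertIncl _ _ κ)
    rw [← hW, ← neg_eq_zero, ← omegaL_cons_eq_neg_extDeriv hL, hΩ]
  have hcontact := contactForm_eq_zero_of_extDeriv_eq_zero (X := Eu m) (Y := Eu n) (by simp)
    (FibredChart.differentiableAt_volCoord hη (FibredChart.total_fst_mem
      (mem_chartAt_source.1 hj))) (contDiffAt_coordFun hL hj)
    (fun _ => eq_zero_of_velocityHessian_eq_zero hη hL hreg j) hZ hd i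
  rw [structureForm_apply_eq_dtotalSymm hj]
  exact (congrArg (fun u => j.fibredChart.dtotalSymm _ (0, u)) hcontact).trans (map_zero _)

end J1

end SmoothFibreBundle

end

theorem mainTheorem7_general {m n : ℕ} {M F E : Type*}
    [TopologicalSpace M] [ChartedSpace (Eu m) M] [IsManifold (𝓡 m) ∞ M]
    [TopologicalSpace F] [ChartedSpace (Eu n) F] [IsManifold (𝓡 n) ∞ F]
    [TopologicalSpace E] [ChartedSpace (Eu (m + n)) E] [IsManifold (𝓡 (m + n)) ∞ E]
    {B : SmoothFibreBundle m n M F E}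
    {η : (x : M) → TangentSpace (𝓡 m) x [⋀^Fin m]→L[ℝ] ℝ} (hη : IsSmoothForm η)
    {L : B.J1 → ℝ} (hL : ContMDiff 𝓘(ℝ, SmoothFibreBundle.J1Model m n) 𝓘(ℝ, ℝ) 2 L)
    (hreg : SmoothFibreBundle.IsRegularLagrangian η L)
    {X : (j : B.J1) → ⋀[ℝ]^m (TangentSpace 𝓘(ℝ, SmoothFibreBundle.J1Model m n) j)}
    (hX : ∀ j, ∃ Y : Fin m → TangentSpace 𝓘(ℝ, SmoothFibreBundle.J1Model m n) j,
      X j = exteriorPower.ιMulti ℝ m Y)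
    (hXω : ∀ j, mvPair (X j) (SmoothFibreBundle.volPullback η j) ≠ 0)
    (hXΩ : ∀ j, mvContract (X j) (SmoothFibreBundle.omegaL η L j) = 0) :
    SmoothFibreBundle.IsSemiHolonomic X := by
  intro j β ζ
  obtain ⟨Y, hY⟩ := hX j
  have hω : SmoothFibreBundle.volPullback η j Y ≠ 0 := by
    rw [← mvPair_ιMulti, ← hY]
    exact hXω j
  have hΩ (W) : SmoothFibreBundle.omegaL η L j (Fin.cons W Y) = 0 := by
    have hcontract := mvContract_ιMulti Y (SmoothFibreBundle.omegaL η L j) W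
    rw [← hY, hXΩ j] at hcontract
    exact (mul_eq_zero.1 hcontract.symm).resolve_left (pow_ne_zero m (neg_ne_zero.2 one_ne_zero))
  have hvert (i : Fin m) : ζ (j.vertEndo (Y i) β) = 0 := by
    rw [SmoothFibreBundle.J1.vertEndo_eq_zero_of_structureForm_eq_zero
      (SmoothFibreBundle.J1.structureForm_eq_zero_of_isRegularLagrangian hη hL hreg hω hΩ i),
      map_zero]
  exact (congrArg _ (congrArg Subtype.val hY)).trans
    (contractLeft_ιMulti_eq_zero (ζ ∘ₗ j.vertEndo.flip β) Y hvert)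

theorem mainTheorem7 {m n : ℕ} {M F E : Type*}
    [TopologicalSpace M] [ChartedSpace (Eu m) M] [IsManifold (𝓡 m) ∞ M]
    [TopologicalSpace F] [ChartedSpace (Eu n) F] [IsManifold (𝓡 n) ∞ F]
    [TopologicalSpace E] [ChartedSpace (Eu (m + n)) E] [IsManifold (𝓡 (m + n)) ∞ E]
    (B : SmoothFibreBundle m n M F E)
    (η : (x : M) → TangentSpace (𝓡 m) x [⋀^Fin m]→L[ℝ] ℝ)
    (hη : IsSmoothForm η) (hη0 : ∀ x, η x ≠ 0)
    (L : B.J1 → ℝ) (hL : ContMDiff 𝓘(ℝ, SmoothFibreBundle.J1Model m n) 𝓘(ℝ, ℝ) ∞ L)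
    (hreg : SmoothFibreBundle.IsRegularLagrangian η L)
    (X : (j : B.J1) → ⋀[ℝ]^m (TangentSpace 𝓘(ℝ, SmoothFibreBundle.J1Model m n) j))
    (hX : IsLocallyDecomposable X)
    (hXω : ∀ j, mvPair (X j) (SmoothFibreBundle.volPullback η j) = 1)
    (hXΩ : ∀ j, mvContract (X j) (SmoothFibreBundle.omegaL η L j) = 0) :
    SmoothFibreBundle.IsSemiHolonomic X ∧ SmoothFibreBundle.IsEulerLagrange η L X := by
  have hsemi := mainTheorem7_general hη (hL.of_le (WithTop.coe_le_coe.2 le_top)) hreg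
    hX.exists_eq_ιMulti (fun j => (hXω j).symm ▸ one_ne_zero) hXΩ
  exact ⟨hsemi, hX, hsemi, hXΩ⟩
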